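/- Let $U$ be a two-qubit controlled-unitary operation, i.e. $U=(v_1\otimes v_2)\,(|0\rangle\langle 0|\otimes I+|1\rangle\langle 1|\otimes u)\,(w_1\otimes w_2)$ with single-qubit unitaries $u,v_1,v_2,w_1,w_2$. Two two-qubit operations are called locally equivalent if they differ only by multiplication on the left and on the right with tensor products of single-qubit unitaries. Assume that $U$ is not locally equivalent to the identity (equivalently, $U$ is locally equivalent to $U_\theta=\mathrm{diag}(1,1,1,e^{i\theta})$ for some $\theta$ with $e^{i\theta}\neq 1$). For a bipartite unit vector $|\psi\rangle\in\mathbb C^m\otimes\mathbb C^n$, the Schmidt number is the number of its nonzero Schmidt coefficients, $|\psi\rangle$ is called maximally entangled if its nonzero Schmidt coefficients are all equal, and its entanglement is the base-2 entropy $E(\psi)=-\sum_i s_i^2\log_2 s_i^2$ of its Schmidt coefficients $s_i$, measured in ebits. An LOCC protocol consists of finitely many turns; at each turn Alice or Bob performs, on her or his own finite-dimensional system, a generalized measurement with finitely many outcomes (measurement operators $M^{(r)}$ with $\sum_r M^{(r)\dagger}M^{(r)}=I$, possibly changing the dimension of the local system) and announces the outcome, on which all later choices may depend. The protocol realizes a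 completely positive trace-preserving map $\Gamma$, and it implements $U$ deterministically with resource $|\psi\rangle$ if $\Gamma(\rho\otimes|\psi\rangle\langle\psi|)=U\rho U^\dagger$ for all two-qubit density operators $\rho$, where Alice holds the first input qubit and the factor $\mathbb C^m$, and Bob holds the second input qubit and the factor $\mathbb C^n$. Then: 1. If some LOCC protocol implements $U$ deterministically with a pure resource state $|\psi\rangle$ of Schmidt number $2$, then $|\psi\rangle$ is maximally entangled, and so $E(\psi)=1$ ebit. 2. Conversely, every maximally entangled pure state of Schmidt number $2$ is a resource with which $U$ can be implemented deterministically by an LOCC protocol with three turns. 3. Consequently, the minimum entanglement cost of $U$ over pure resource states of Schmidt number $2$, i.e. the least $E(\psi)$ over all $|\psi\rangle$ of Schmidt number $2$ with which $U$ can be implemented deterministically by LOCC, is exactly $1$ ebit. 4. Let the entangling power of $U$ be the supremum of the entanglement of the states that $U$ creates from pure product states of Alice and Bob (with local ancillas of arbitrary finite dimension allowed). It is at most $1$ ebit, and it is strictly less than $1$ ebit if and only if $U$ is not locally equivalent to the controlled-NOT operation. Hence for every such $U$ not locally equivalent to the controlled-NOT there is a gap between the minimum entanglement cost of part 3 and the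 entangling power. -/

import Mathlib

open scoped Matrix Kronecker ComplexOrder

noncomputable section

namespace LOCCCost

/-- Operators on two qubits; the first index is Alice's qubit, the second is Bob's. -/
abbrev TwoQubitOp : Type := Matrix (Fin 2 × Fin 2) (Fin 2 × Fin 2) ℂ

/-- The controlled operation `|0⟩⟨0| ⊗ 1 + |1⟩⟨1| ⊗ u`. -/
def controlled (u : Matrix (Fin 2) (Fin 2) ℂ) : TwoQubitOp :=
  Matrix.single 0 0 1 ⊗ₖ 1 + Matrix.single 1 1 1 ⊗ₖ u

/-- The controlled-NOT operation. -/
def cnot : TwoQubitOp := controlled !![0, 1; 1, 0]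

/-- `U = (v₁ ⊗ v₂) V (w₁ ⊗ w₂)` with single-qubit unitaries `v₁, v₂, w₁, w₂`. -/
def LocallyEquivalent (U V : TwoQubitOp) : Prop :=
  ∃ v₁ v₂ w₁ w₂ : Matrix.unitaryGroup (Fin 2) ℂ,
    U = ((v₁ : Matrix (Fin 2) (Fin 2) ℂ) ⊗ₖ (v₂ : Matrix (Fin 2) (Fin 2) ℂ)) * V *
      ((w₁ : Matrix (Fin 2) (Fin 2) ℂ) ⊗ₖ (w₂ : Matrix (Fin 2) (Fin 2) ℂ))

/-- Two-qubit controlled-unitary operations, up to local unitaries. -/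
def IsControlledUnitary (U : TwoQubitOp) : Prop :=
  ∃ u : Matrix.unitaryGroup (Fin 2) ℂ, LocallyEquivalent U (controlled u)

/-- Unit vectors, in coordinates. -/
def IsPureState {ι : Type*} [Fintype ι] (ψ : ι → ℂ) : Prop :=
  ∑ x, ‖ψ x‖ ^ 2 = 1

/-- Density operators. -/
def IsDensity {ι : Type*} [Fintype ι] (ρ : Matrix ι ι ℂ) : Prop :=
  ρ.PosSemidef ∧ ρ.trace = 1

section Schmidt

variable {A B : Type*} [Fintype A] [DecidableEq A] [Fintype B]

/-- The coefficient matrix `ψ_{ij}` of a bipartite vector. -/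
def coeffMatrix (ψ : A × B → ℂ) : Matrix A B ℂ := Matrix.of fun i j => ψ (i, j)

/-- The reduced operator `Tr_B |ψ⟩⟨ψ|`. -/
def reduced (ψ : A × B → ℂ) : Matrix A A ℂ := coeffMatrix ψ * (coeffMatrix ψ)ᴴ

theorem reduced_isHermitian {A B : Type*} [Fintype B] (ψ : A × B → ℂ) : (reduced ψ).IsHermitian :=
  Matrix.isHermitian_mul_conjTranspose_self _

/-- The Schmidt coefficients of `ψ` (padded by zeros): the square roots of the eigenvalues,
with multiplicity, of the reduced operator. -/
def schmidtCoeff (ψ : A × B → ℂ) (i : A) : ℝ :=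
  Real.sqrt ((reduced_isHermitian ψ).eigenvalues i)

/-- The Schmidt number: the number of nonzero Schmidt coefficients. -/
def schmidtNumber (ψ : A × B → ℂ) : ℕ := Nat.card {i : A // schmidtCoeff ψ i ≠ 0}

/-- All nonzero Schmidt coefficients are equal. -/
def IsMaximallyEntangled (ψ : A × B → ℂ) : Prop :=
  ∀ i j, schmidtCoeff ψ i ≠ 0 → schmidtCoeff ψ j ≠ 0 → schmidtCoeff ψ i = schmidtCoeff ψ j

/-- Entropy of entanglement, in ebits. -/
def entanglement (ψ : A × B → ℂ) : ℝ :=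
  -∑ i, schmidtCoeff ψ i ^ 2 * Real.logb 2 (schmidtCoeff ψ i ^ 2)

end Schmidt

/-- Two-party LOCC protocols with finitely many turns. `LOCC c d a b` takes Alice's system from
dimension `a` to `c` and Bob's from `b` to `d`. At each turn one of the parties performs a
generalized measurement with finitely many outcomes `r` and announces the outcome; everything
afterwards may depend on it. The measurement operators are only subject to completeness, and may
change the dimension of the local system (ancillas may be adjoined or discarded). -/
inductive LOCC (c d : ℕ) : ℕ → ℕ → Type
  | done : LOCC c d c d
  | alice {a b : ℕ} (k : ℕ) (a' : Fin k → ℕ)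
      (M : (r : Fin k) → Matrix (Fin (a' r)) (Fin a) ℂ)
      (complete : ∑ r, (M r)ᴴ * M r = 1)
      (next : (r : Fin k) → LOCC c d (a' r) b) : LOCC c d a b
  | bob {a b : ℕ} (k : ℕ) (b' : Fin k → ℕ)
      (K : (r : Fin k) → Matrix (Fin (b' r)) (Fin b) ℂ)
      (complete : ∑ r, (K r)ᴴ * K r = 1)
      (next : (r : Fin k) → LOCC c d a (b' r)) : LOCC c d a b

namespace LOCC

/-- The number of turns (length of the longest branch). -/
def turns {c d : ℕ} : {a b : ℕ} → LOCC c d a b → ℕ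
  | _, _, done => 0
  | _, _, alice _ _ _ _ next => 1 + Finset.univ.sup fun r => (next r).turns
  | _, _, bob _ _ _ _ next => 1 + Finset.univ.sup fun r => (next r).turns

/-- The completely positive trace-preserving map realized by a protocol. -/
def channel {c d : ℕ} : {a b : ℕ} → LOCC c d a b →
    Matrix (Fin a × Fin b) (Fin a × Fin b) ℂ → Matrix (Fin c × Fin d) (Fin c × Fin d) ℂ
  | _, _, done, ρ => ρ
  | _, b, alice _ _ M _ next, ρ =>
      ∑ r, (next r).channel
        ((M r ⊗ₖ (1 : Matrix (Fin b) (Fin b) ℂ)) * ρ *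
          (M r ⊗ₖ (1 : Matrix (Fin b) (Fin b) ℂ))ᴴ)
  | a, _, bob _ _ K _ next, ρ =>
      ∑ r, (next r).channel
        (((1 : Matrix (Fin a) (Fin a) ℂ) ⊗ₖ K r) * ρ *
          ((1 : Matrix (Fin a) (Fin a) ℂ) ⊗ₖ K r)ᴴ)

end LOCC

/-- The operator `ρ_in ⊗ |ψ⟩⟨ψ|`, with the factors grouped by party: Alice holds
`ℂ² ⊗ ℂᵐ ≅ ℂ²ᵐ` and Bob holds `ℂ² ⊗ ℂⁿ ≅ ℂ²ⁿ`. -/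
def jointState {m n : ℕ} (ρ : TwoQubitOp) (ψ : Fin m × Fin n → ℂ) :
    Matrix (Fin (2 * m) × Fin (2 * n)) (Fin (2 * m) × Fin (2 * n)) ℂ :=
  Matrix.of fun x y =>
    let x₁ := finProdFinEquiv.symm x.1
    let x₂ := finProdFinEquiv.symm x.2
    let y₁ := finProdFinEquiv.symm y.1
    let y₂ := finProdFinEquiv.symm y.2
    ρ (x₁.1, x₂.1) (y₁.1, y₂.1) * (ψ (x₁.2, x₂.2) * star (ψ (y₁.2, y₂.2)))

/-- The protocol `P`, assisted by the resource `ψ`, implements `U` deterministically on every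
(unknown) input state. -/
def Implements {m n : ℕ} (P : LOCC 2 2 (2 * m) (2 * n)) (ψ : Fin m × Fin n → ℂ)
    (U : TwoQubitOp) : Prop :=
  ∀ ρ : TwoQubitOp, IsDensity ρ → P.channel (jointState ρ ψ) = U * ρ * Uᴴ

/-- The vector obtained by applying `U` to the two qubits of the product vector `α ⊗ β`, where each
party's qubit comes with a local ancilla. -/
def applyToProduct {p q : ℕ} (U : TwoQubitOp) (α : Fin 2 × Fin p → ℂ) (β : Fin 2 × Fin q → ℂ) :
    (Fin 2 × Fin p) × (Fin 2 × Fin q) → ℂ :=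
  fun x => ∑ i : Fin 2, ∑ j : Fin 2, U (x.1.1, x.2.1) (i, j) * (α (i, x.1.2) * β (j, x.2.2))

/-- Entangling power: the supremum of the entanglement that `U` creates from pure product states
(local ancillas of any finite dimension allowed). -/
def entanglingPower (U : TwoQubitOp) : EReal :=
  ⨆ (p : ℕ) (q : ℕ) (α : Fin 2 × Fin p → ℂ) (β : Fin 2 × Fin q → ℂ)
    (_ : IsPureState α) (_ : IsPureState β), (entanglement (applyToProduct U α β) : EReal)

end LOCCCost

end

/-! Rigidity of the resource. A protocol is a separable operation with Kraus operators `E k ⊗ₖ F k`.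
Let `J` adjoin the resource. Since the output is a unitary conjugation, each `(E k ⊗ₖ F k) * J` is a
multiple `c k • U`, with `∑ |c k|² = 1`. A nonlocal controlled unitary has operator Schmidt rank
two, so there are functionals `α a`, `β b` whose products send `U` to the 2 × 2 identity. Applied to
the blocks of `E k` and `F k`, they give matrices `X k`, `Y k` with `(X k)ᵀ C (Y k) = c k • 1`,
where `C` is the coefficient matrix of the resource. Completeness gives the dual relation `∑ conj (c
k) Y k (X k)ᵀ = 2 Cᴴ`. As `C = P Q` factors through dimension two, `(X k)ᵀ P` and `Q (Y k)` are
square with scalar product, so for `c k ≠ 0` they commute and `C Y k (X k)ᵀ C = c k C`. Averaging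
yields `2 C Cᴴ C = C`: every nonzero eigenvalue of the reduced operator is 1/2
(`flat_of_dual_families`, `reduced_mul_self_of_implements`).

Sufficiency. Alice copies the control bit, up to a known shift, onto Bob's half of the Bell pair.
Bob applies the controlled gate locally and measures his half in the Fourier basis, and Alice undoes
the resulting sign on the control. Every branch equals `U / 2`.

Entangling power. The created state has Schmidt number at most two, and its purity depends only on
the control weights `g₀`, `g₁` and the overlap `⟨β|u|β⟩`. The modulus of this overlap is at least
`|tr u| / 2`, because an element of SU(2) has expectations of constant real part. So the entropy
stays uniformly below one ebit unless `tr u = 0`. In that case `u` is a phase times a conjugate of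
NOT and `U` is equivalent to CNOT, which attains one ebit on `|+⟩|0⟩`. -/

noncomputable section

namespace LOCCCost

/-! ### Protocols as separable operations -/

/-- Every LOCC protocol is a separable operation. -/
theorem LOCC.exists_separable_kraus {c d a b : ℕ} (P : LOCC c d a b) :
    ∃ (ι : Type) (_ : Fintype ι) (E : ι → Matrix (Fin c) (Fin a) ℂ)
      (F : ι → Matrix (Fin d) (Fin b) ℂ),
      (∑ k, (E k ⊗ₖ F k)ᴴ * (E k ⊗ₖ F k) = 1) ∧
      ∀ ρ, P.channel ρ = ∑ k, (E k ⊗ₖ F k) * ρ * (E k ⊗ₖ F k)ᴴ := by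
  induction P with
  | done => exact ⟨Unit, inferInstance, fun _ => 1, fun _ => 1, by simp, by simp [LOCC.channel]⟩
  | @alice a b k a' M hM next ih =>
    choose ι hι E F hEF hch using ih
    have hfac : ∀ r (i : ι r), (E r i * M r) ⊗ₖ F r i =
        (E r i ⊗ₖ F r i) * (M r ⊗ₖ (1 : Matrix (Fin b) (Fin b) ℂ)) := fun r i => by
      rw [← Matrix.mul_kronecker_mul, Matrix.mul_one]
    refine ⟨Σ r, ι r, inferInstance, fun x => E x.1 x.2 * M x.1, fun x => F x.1 x.2, ?_, ?_⟩
    · simp only [Fintype.sum_sigma, hfac, Matrix.conjTranspose_mul, Matrix.mul_assoc]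
      have : ∀ r, ∑ i, (M r ⊗ₖ (1 : Matrix (Fin b) (Fin b) ℂ))ᴴ * ((E r i ⊗ₖ F r i)ᴴ *
          ((E r i ⊗ₖ F r i) * (M r ⊗ₖ (1 : Matrix (Fin b) (Fin b) ℂ)))) =
          ((M r)ᴴ * M r) ⊗ₖ (1 : Matrix (Fin b) (Fin b) ℂ) := fun r => by
        rw [← Matrix.mul_sum]
        simp only [← Matrix.mul_assoc (_ᴴ) (E r _ ⊗ₖ F r _)]
        rw [← Matrix.sum_mul, hEF, Matrix.one_mul, Matrix.conjTranspose_kronecker,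
          ← Matrix.mul_kronecker_mul, Matrix.conjTranspose_one, Matrix.one_mul]
      simp only [this]
      rw [← Matrix.one_kronecker_one, ← hM]
      ext x y
      simp [Matrix.sum_apply, Finset.sum_mul]
    · intro ρ
      simp only [Fintype.sum_sigma, hfac, LOCC.channel, hch, Matrix.conjTranspose_mul,
        Matrix.mul_assoc]
  | @bob a b k b' K hK next ih =>
    choose ι hι E F hEF hch using ih
    have hfac : ∀ r (i : ι r), E r i ⊗ₖ (F r i * K r) =
        (E r i ⊗ₖ F r i) * ((1 : Matrix (Fin a) (Fin a) ℂ) ⊗ₖ K r) := fun r i => by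
      rw [← Matrix.mul_kronecker_mul, Matrix.mul_one]
    refine ⟨Σ r, ι r, inferInstance, fun x => E x.1 x.2, fun x => F x.1 x.2 * K x.1, ?_, ?_⟩
    · simp only [Fintype.sum_sigma, hfac, Matrix.conjTranspose_mul, Matrix.mul_assoc]
      have : ∀ r, ∑ i, ((1 : Matrix (Fin a) (Fin a) ℂ) ⊗ₖ K r)ᴴ * ((E r i ⊗ₖ F r i)ᴴ *
          ((E r i ⊗ₖ F r i) * ((1 : Matrix (Fin a) (Fin a) ℂ) ⊗ₖ K r))) =
          (1 : Matrix (Fin a) (Fin a) ℂ) ⊗ₖ ((K r)ᴴ * K r) := fun r => by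
        rw [← Matrix.mul_sum]
        simp only [← Matrix.mul_assoc (_ᴴ) (E r _ ⊗ₖ F r _)]
        rw [← Matrix.sum_mul, hEF, Matrix.one_mul, Matrix.conjTranspose_kronecker,
          ← Matrix.mul_kronecker_mul, Matrix.conjTranspose_one, Matrix.one_mul]
      simp only [this]
      rw [← Matrix.one_kronecker_one, ← hK]
      ext x y
      simp [Matrix.sum_apply, Finset.mul_sum]
    · intro ρ
      simp only [Fintype.sum_sigma, hfac, LOCC.channel, hch, Matrix.conjTranspose_mul,
        Matrix.mul_assoc]

/-- Kraus operators of a unitary conjugation are proportional to the unitary. -/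
theorem kraus_eq_smul_of_unitary {ι κ : Type*} [Fintype ι] [DecidableEq ι] [Inhabited ι]
    [Fintype κ] (U : Matrix ι ι ℂ) (hU : Uᴴ * U = 1) (N : κ → Matrix ι ι ℂ)
    (h : ∀ v : ι → ℂ, ∑ k, N k * Matrix.vecMulVec v (star v) * (N k)ᴴ =
      U * Matrix.vecMulVec v (star v) * Uᴴ) (k : κ) : ∃ c : ℂ, N k = c • U := by
  -- In the expectation at `U w` the target gives `|⟨w, v⟩|² = 0` and the Kraus sum gives a sum of
  -- squared moduli, so each term vanishes.
  have key : ∀ v w : ι → ℂ, star w ⬝ᵥ v = 0 → star w ⬝ᵥ ((Uᴴ * N k) *ᵥ v) = 0 := by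
    intro v w hvw
    have h1 : ∀ A : Matrix ι ι ℂ, star w ⬝ᵥ ((Uᴴ * (A * Matrix.vecMulVec v (star v) * Aᴴ) * U) *ᵥ w)
        = (star w ⬝ᵥ ((Uᴴ * A) *ᵥ v)) * star (star w ⬝ᵥ ((Uᴴ * A) *ᵥ v)) := by
      intro A
      have : Uᴴ * (A * Matrix.vecMulVec v (star v) * Aᴴ) * U =
          Matrix.vecMulVec ((Uᴴ * A) *ᵥ v) (star ((Uᴴ * A) *ᵥ v)) := by
        rw [← Matrix.mul_vecMulVec, Matrix.star_mulVec, ← Matrix.vecMulVec_mul]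
        simp [Matrix.conjTranspose_mul, Matrix.mul_assoc]
      rw [this, Matrix.vecMulVec_mulVec, ← Matrix.star_dotProduct]
      simp [mul_comm]
    have h2 := congrArg (fun A => star w ⬝ᵥ ((Uᴴ * A * U) *ᵥ w)) (h v)
    simp only [Matrix.mul_sum, Matrix.sum_mul, Matrix.sum_mulVec, dotProduct_sum, h1] at h2
    rw [hU, Matrix.one_mulVec, hvw, zero_mul] at h2
    have h3 : ∀ z : ℂ, z * star z = ((‖z‖ ^ 2 : ℝ) : ℂ) := fun z => by
      simpa using Complex.mul_conj' z
    simp only [h3] at h2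
    norm_cast at h2
    have h4 := (Finset.sum_eq_zero_iff_of_nonneg (fun i _ => by positivity)).1 h2 k
      (Finset.mem_univ _)
    simpa using h4
  have hoff : ∀ i j, i ≠ j → (Uᴴ * N k) i j = 0 := by
    intro i j hij
    have := key (Pi.single j 1) (Pi.single i 1) (by simp [hij])
    simpa using this
  -- The orthogonal pair `e i + e j`, `e i - e j` compares the two diagonal entries.
  have hdiag : ∀ i j, (Uᴴ * N k) i i = (Uᴴ * N k) j j := by
    intro i j
    rcases eq_or_ne i j with rfl | hij
    · rfl
    have := key (Pi.single i 1 + Pi.single j 1) (Pi.single i 1 - Pi.single j 1)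
      (by simp [hij, hij.symm, dotProduct_add])
    simp [sub_dotProduct, Matrix.mulVec_add, dotProduct_add, hoff i j hij, hoff j i hij.symm]
      at this
    linear_combination this
  refine ⟨(Uᴴ * N k) default default, ?_⟩
  have : Uᴴ * N k = (Uᴴ * N k) default default • (1 : Matrix ι ι ℂ) := by
    ext i j
    rcases eq_or_ne i j with rfl | hij
    · simp [hdiag i default]
    · simp [hoff i j hij, hij]
  calc N k = U * (Uᴴ * N k) := by rw [← Matrix.mul_assoc, mul_eq_one_comm.1 hU, Matrix.one_mul]
    _ = _ := by rw [this]; simp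

/-- The isometry `φ ↦ φ ⊗ ψ`, with the factors grouped by party. -/
def adjoin {m n : ℕ} (ψ : Fin m × Fin n → ℂ) :
    Matrix (Fin (2 * m) × Fin (2 * n)) (Fin 2 × Fin 2) ℂ :=
  Matrix.of fun x y =>
    if y = ((finProdFinEquiv.symm x.1).1, (finProdFinEquiv.symm x.2).1) then
      ψ ((finProdFinEquiv.symm x.1).2, (finProdFinEquiv.symm x.2).2) else 0

theorem jointState_eq {m n : ℕ} (ρ : TwoQubitOp) (ψ : Fin m × Fin n → ℂ) :
    jointState ρ ψ = adjoin ψ * ρ * (adjoin ψ)ᴴ := by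
  ext x y
  simp only [jointState, adjoin, Matrix.of_apply, Matrix.mul_apply, Matrix.conjTranspose_apply,
    ite_mul, zero_mul, Finset.sum_ite_eq', Finset.mem_univ, if_true, apply_ite star, star_zero,
    mul_ite, mul_zero]
  ring

theorem sum_fin_two_mul {M : Type*} [AddCommMonoid M] {m : ℕ} (f : Fin (2 * m) → M) :
    ∑ x, f x = ∑ i : Fin 2, ∑ j : Fin m, f (finProdFinEquiv (i, j)) := by
  rw [← finProdFinEquiv.sum_comp, Fintype.sum_prod_type]

theorem adjoin_isometry {m n : ℕ} {ψ : Fin m × Fin n → ℂ} (hψ : IsPureState ψ) :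
    (adjoin ψ)ᴴ * adjoin ψ = 1 := by
  have h3 : ∀ z : ℂ, star z * z = ((‖z‖ ^ 2 : ℝ) : ℂ) := fun z => by
    simpa using Complex.conj_mul' z
  have hψ' : ∑ j, ∑ l, star (ψ (j, l)) * ψ (j, l) = 1 := by
    rw [← Fintype.sum_prod_type (f := fun x => star (ψ x) * ψ x)]
    simp only [h3]
    rw [IsPureState] at hψ
    exact_mod_cast hψ
  ext ⟨a, b⟩ ⟨a', b'⟩
  simp only [Matrix.mul_apply, Fintype.sum_prod_type, sum_fin_two_mul, Matrix.conjTranspose_apply,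
    adjoin, Matrix.of_apply, Equiv.symm_apply_apply, Prod.mk.injEq, Matrix.one_apply]
  fin_cases a <;> fin_cases b <;> fin_cases a' <;> fin_cases b' <;>
    simp [Fin.sum_univ_two] <;> simpa using hψ'

/-- The block of a local operator on `ℂ² ⊗ ℂᵐ` belonging to the basis vector `j` of `ℂᵐ`. -/
def block {c m : ℕ} (E : Matrix (Fin c) (Fin (2 * m)) ℂ) (j : Fin m) : Matrix (Fin c) (Fin 2) ℂ :=
  E.submatrix id fun a => finProdFinEquiv (a, j)

/-- In this form a product functional turns a Kraus branch into a bilinear expression in the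
coefficient matrix of the resource. -/
theorem kronecker_mul_adjoin {c d m n : ℕ} (E : Matrix (Fin c) (Fin (2 * m)) ℂ)
    (F : Matrix (Fin d) (Fin (2 * n)) ℂ) (ψ : Fin m × Fin n → ℂ) :
    (E ⊗ₖ F) * adjoin ψ = ∑ j, ∑ l, ψ (j, l) • (block E j ⊗ₖ block F l) := by
  ext ⟨o, o'⟩ ⟨a, b⟩
  simp only [Matrix.mul_apply, Fintype.sum_prod_type, sum_fin_two_mul, adjoin, Matrix.of_apply,
    Equiv.symm_apply_apply, Prod.mk.injEq, Matrix.sum_apply, Matrix.smul_apply, smul_eq_mul,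
    Matrix.kroneckerMap_apply, block, Matrix.submatrix_apply, id]
  fin_cases a <;> fin_cases b <;> simp [Fin.sum_univ_two, mul_comm]

/-- The product of two linear functionals. -/
def prodFunctional (α β : Matrix (Fin 2) (Fin 2) ℂ →ₗ[ℂ] ℂ) : TwoQubitOp →ₗ[ℂ] ℂ :=
  α ∘ₗ
    { toFun := fun N => Matrix.of fun i j => β (Matrix.of fun k l => N (i, k) (j, l))
      map_add' := fun N N' => by
        ext i j
        simp only [Matrix.of_apply, Matrix.add_apply, ← map_add]
        rfl
      map_smul' := fun z N => by
        ext i j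
        simp only [Matrix.of_apply, Matrix.smul_apply, RingHom.id_apply, ← map_smul]
        rfl }

theorem prodFunctional_kronecker (α β : Matrix (Fin 2) (Fin 2) ℂ →ₗ[ℂ] ℂ)
    (A B : Matrix (Fin 2) (Fin 2) ℂ) : prodFunctional α β (A ⊗ₖ B) = α A * β B := by
  have h1 : ∀ i j, β (Matrix.of fun k l => (A ⊗ₖ B) (i, k) (j, l)) = A i j * β B := by
    intro i j
    rw [← smul_eq_mul, ← map_smul]
    rfl
  have h2 : (Matrix.of fun i j => β (Matrix.of fun k l => (A ⊗ₖ B) (i, k) (j, l))) = β B • A := by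
    ext i j
    simp only [Matrix.of_apply, h1, Matrix.smul_apply, smul_eq_mul, mul_comm]
  simp only [prodFunctional, LinearMap.comp_apply, LinearMap.coe_mk, AddHom.coe_mk]
  rw [h2, map_smul, smul_eq_mul, mul_comm]

/-- If `1` and `u` are linearly independent, there are functionals dual to them. -/
theorem exists_dual_functionals (u : Matrix (Fin 2) (Fin 2) ℂ) (hu : ∀ z : ℂ, u ≠ z • 1) :
    ∃ β : Fin 2 → (Matrix (Fin 2) (Fin 2) ℂ →ₗ[ℂ] ℂ),
      β 0 1 = 1 ∧ β 0 u = 0 ∧ β 1 1 = 0 ∧ β 1 u = 1 := by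
  let e : Fin 2 → Fin 2 → (Matrix (Fin 2) (Fin 2) ℂ →ₗ[ℂ] ℂ) := fun i j => Matrix.entryLinearMap ℂ ℂ i j
  obtain ⟨f, hf1, hfu⟩ : ∃ f : Matrix (Fin 2) (Fin 2) ℂ →ₗ[ℂ] ℂ, f 1 = 0 ∧ f u = 1 := by
    -- A non-scalar matrix has a nonzero off-diagonal entry or unequal diagonal entries. Each gives
    -- a functional that kills `1` but not `u`.
    by_cases h01 : u 0 1 = 0
    · by_cases h10 : u 1 0 = 0
      · have hd : u 0 0 - u 1 1 ≠ 0 := by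
          intro h
          apply hu (u 0 0)
          ext i j
          fin_cases i <;> fin_cases j <;> simp [h01, h10]
          linear_combination -h
        exact ⟨(u 0 0 - u 1 1)⁻¹ • (e 0 0 - e 1 1), by simp [e], by simp [e, hd]⟩
      · exact ⟨(u 1 0)⁻¹ • e 1 0, by simp [e], by simp [e, h10]⟩
    · exact ⟨(u 0 1)⁻¹ • e 0 1, by simp [e], by simp [e, h01]⟩
  exact ⟨![e 0 0 - u 0 0 • f, f], by simp [e, hf1], by simp [e, hfu], by simpa, by simpa⟩

/-! ### Schmidt decomposition -/

/-- An isometry onto the support of the reduced operator, for Schmidt number two. -/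
theorem exists_schmidt_isometry {A B : Type*} [Fintype A] [DecidableEq A] [Fintype B]
    (ψ : A × B → ℂ) (h : schmidtNumber ψ = 2) :
    ∃ (e : Fin 2 → A) (P : Matrix A (Fin 2) ℂ), Function.Injective e ∧
      (∀ i, schmidtCoeff ψ i ≠ 0 ↔ i ∈ Set.range e) ∧ Pᴴ * P = 1 ∧
      reduced ψ = P * Matrix.diagonal
        (fun j => (((reduced_isHermitian ψ).eigenvalues (e j) : ℝ) : ℂ)) * Pᴴ ∧
      P * (Pᴴ * coeffMatrix ψ) = coeffMatrix ψ := by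
  classical
  have hR := reduced_isHermitian ψ
  have hpos : ∀ i, 0 ≤ hR.eigenvalues i :=
    fun i => (Matrix.posSemidef_self_mul_conjTranspose (coeffMatrix ψ)).eigenvalues_nonneg i
  rw [schmidtNumber, Nat.card_eq_fintype_card] at h
  let ε : Fin 2 ≃ {i : A // schmidtCoeff ψ i ≠ 0} := (Fintype.equivFinOfCardEq h).symm
  let e : Fin 2 → A := fun j => (ε j : A)
  have hinj : Function.Injective e := Subtype.val_injective.comp ε.injective
  have hrange : ∀ i, schmidtCoeff ψ i ≠ 0 ↔ i ∈ Set.range e := by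
    intro i
    constructor
    · intro hi
      exact ⟨ε.symm ⟨i, hi⟩, by simp [e]⟩
    · rintro ⟨j, rfl⟩
      exact (ε j).2
  let V : Matrix A A ℂ := hR.eigenvectorUnitary
  have hV : Vᴴ * V = 1 := Unitary.coe_star_mul_self hR.eigenvectorUnitary
  have hspec : reduced ψ = V * Matrix.diagonal (fun i => ((hR.eigenvalues i : ℝ) : ℂ)) * Vᴴ := by
    have := hR.spectral_theorem
    rw [Unitary.conjStarAlgAut_apply] at this
    exact this
  let P : Matrix A (Fin 2) ℂ := V.submatrix id e
  have hPP : Pᴴ * P = 1 := by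
    ext i j
    have := congrFun (congrFun hV (e i)) (e j)
    simp only [Matrix.mul_apply, Matrix.conjTranspose_apply, P, Matrix.submatrix_apply, id] at this ⊢
    rw [this]
    simp [Matrix.one_apply, hinj.eq_iff]
  have hRP : reduced ψ = P * Matrix.diagonal
        (fun j => ((hR.eigenvalues (e j) : ℝ) : ℂ)) * Pᴴ := by
    ext x y
    refine (congrFun (congrFun hspec x) y).trans ?_
    rw [Matrix.mul_apply, Matrix.mul_apply]
    simp only [Matrix.mul_diagonal, Matrix.conjTranspose_apply, P, Matrix.submatrix_apply, id]
    rw [← Finset.sum_image (s := Finset.univ) (g := e) (fun a _ b _ hab => hinj hab)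
      (f := fun i => V x i * ((hR.eigenvalues i : ℝ) : ℂ) * star (V y i))]
    symm
    apply Finset.sum_subset (Finset.subset_univ _)
    intro i _ hi
    have h0 : schmidtCoeff ψ i = 0 := by
      by_contra hne
      obtain ⟨j, rfl⟩ := (hrange i).1 hne
      exact hi (Finset.mem_image_of_mem _ (Finset.mem_univ _))
    rw [schmidtCoeff, Real.sqrt_eq_zero (hpos i)] at h0
    simp [h0]
  refine ⟨e, P, hinj, hrange, hPP, hRP, ?_⟩
  -- The component of `C` outside the range of `P` has zero Gram matrix, because `P * Pᴴ` fixes `C *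
  -- Cᴴ`.
  have h0 : (coeffMatrix ψ - P * (Pᴴ * coeffMatrix ψ)) *
      (coeffMatrix ψ - P * (Pᴴ * coeffMatrix ψ))ᴴ = 0 := by
    have h1 : P * (Pᴴ * reduced ψ) = reduced ψ := by
      rw [hRP]
      simp only [← Matrix.mul_assoc]
      rw [Matrix.mul_assoc P, hPP, Matrix.mul_one]
    have h2 : (coeffMatrix ψ - P * (Pᴴ * coeffMatrix ψ)) * (coeffMatrix ψ)ᴴ = 0 := by
      rw [Matrix.sub_mul, Matrix.mul_assoc, Matrix.mul_assoc, ← reduced, h1, sub_self]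
    rw [Matrix.conjTranspose_sub, Matrix.mul_sub, h2, Matrix.conjTranspose_mul,
      Matrix.conjTranspose_mul, ← Matrix.mul_assoc, ← Matrix.mul_assoc, h2]
    simp
  exact (sub_eq_zero.1 (Matrix.self_mul_conjTranspose_eq_zero.1 h0)).symm

theorem eigenvalues_of_mul_self {A : Type*} [Fintype A] [DecidableEq A] {R : Matrix A A ℂ}
    (hR : R.IsHermitian) (t : ℝ) (h : R * R = (t : ℂ) • R) (i : A) :
    hR.eigenvalues i = 0 ∨ hR.eigenvalues i = t := by
  have h1 := hR.mulVec_eigenvectorBasis i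
  set v := WithLp.ofLp (hR.eigenvectorBasis i) with hv
  have hv0 : v ≠ 0 := by
    intro h0
    exact hR.eigenvectorBasis.toBasis.ne_zero i (by simpa [hv] using h0)
  have h2 : R *ᵥ (R *ᵥ v) = (t : ℂ) • (R *ᵥ v) := by
    rw [Matrix.mulVec_mulVec, h, Matrix.smul_mulVec]
  rw [h1, Matrix.mulVec_smul, h1] at h2
  obtain ⟨x, hx⟩ := Function.ne_iff.1 hv0
  have h3 := congrFun h2 x
  simp only [Pi.smul_apply, Complex.real_smul, smul_eq_mul] at h3
  simp only [Pi.zero_apply] at hx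
  have h4 : ((hR.eigenvalues i : ℝ) : ℂ) * (hR.eigenvalues i - t) = 0 := by
    apply mul_right_cancel₀ hx
    linear_combination h3
  rcases mul_eq_zero.1 h4 with h5 | h5
  · left; exact_mod_cast h5
  · right
    have := sub_eq_zero.1 h5
    exact_mod_cast this

/-- The quadratic relation leaves 1/2 as the only nonzero eigenvalue. There are two of them, each
contributing 1/2 to the entropy. -/
theorem maximallyEntangled_of_reduced {A B : Type*} [Fintype A] [DecidableEq A] [Fintype B]
    (ψ : A × B → ℂ) (h : reduced ψ * reduced ψ = ((1 / 2 : ℝ) : ℂ) • reduced ψ)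
    (h2 : schmidtNumber ψ = 2) : IsMaximallyEntangled ψ ∧ entanglement ψ = 1 := by
  classical
  have hval : ∀ i, schmidtCoeff ψ i = 0 ∨ schmidtCoeff ψ i = Real.sqrt (1 / 2) := by
    intro i
    rcases eigenvalues_of_mul_self (reduced_isHermitian ψ) _ h i with h | h
    · left; rw [schmidtCoeff, h, Real.sqrt_zero]
    · right; rw [schmidtCoeff, h]
  constructor
  · intro i j hi hj
    rw [(hval i).resolve_left hi, (hval j).resolve_left hj]
  · have hterm : ∀ i, schmidtCoeff ψ i ^ 2 * Real.logb 2 (schmidtCoeff ψ i ^ 2) =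
        if schmidtCoeff ψ i ≠ 0 then -(1 / 2) else 0 := by
      intro i
      rcases hval i with h | h
      · simp [h]
      · have hne : schmidtCoeff ψ i ≠ 0 := by rw [h]; positivity
        have hl : Real.logb 2 (1 / 2) = -1 := by
          rw [one_div, Real.logb_inv, Real.logb_self_eq_one (by norm_num)]
        rw [if_pos hne, h, Real.sq_sqrt (by norm_num), hl]
        norm_num
    rw [schmidtNumber, Nat.card_eq_fintype_card, Fintype.card_subtype] at h2
    rw [entanglement, Finset.sum_congr rfl fun i _ => hterm i, ← Finset.sum_filter,
      Finset.sum_const, h2]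
    norm_num

/-- The linear algebra behind the rigidity of the resource: if rank-two coefficient data invert
`C` up to the factors `c k`, and average to its adjoint, then `C` is flat. -/
theorem flat_of_dual_families {m n : ℕ} {ι : Type*} [Fintype ι] {C : Matrix (Fin m) (Fin n) ℂ}
    {P : Matrix (Fin m) (Fin 2) ℂ} {Q : Matrix (Fin 2) (Fin n) ℂ} (hC : C = P * Q)
    (X : ι → Matrix (Fin m) (Fin 2) ℂ) (Y : ι → Matrix (Fin n) (Fin 2) ℂ) (c : ι → ℂ)
    (hc : ∑ k, star (c k) * c k = 1) (h1 : ∀ k, (X k)ᵀ * C * Y k = c k • 1)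
    (h2 : ∑ k, star (c k) • (Y k * (X k)ᵀ) = (2 : ℂ) • Cᴴ) :
    (2 : ℂ) • (C * Cᴴ * C) = C := by
  -- Branches with `c k = 0` are harmless, because the weight `star (c k)` removes them.
  have h3 : ∀ k, star (c k) • (C * (Y k * (X k)ᵀ) * C) = (star (c k) * c k) • C := by
    intro k
    rcases eq_or_ne (c k) 0 with h0 | h0
    · simp [h0]
    have h4 : ((X k)ᵀ * P) * ((c k)⁻¹ • (Q * Y k)) = 1 := by
      have := h1 k
      rw [hC] at this
      rw [Matrix.mul_smul, Matrix.mul_assoc, ← Matrix.mul_assoc P, ← Matrix.mul_assoc, this,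
        smul_smul, inv_mul_cancel₀ h0, one_smul]
    -- Here the Schmidt number enters: both factors are 2 × 2, so a one-sided inverse is two-sided
    -- and the order may be reversed.
    have h5 : (Q * Y k) * ((X k)ᵀ * P) = c k • 1 := by
      have := mul_eq_one_comm.1 h4
      rw [Matrix.smul_mul] at this
      rw [← this, smul_smul, mul_inv_cancel₀ h0, one_smul]
    have h6 : C * (Y k * (X k)ᵀ) * C = P * ((Q * Y k) * ((X k)ᵀ * P)) * Q := by
      rw [hC]; simp only [Matrix.mul_assoc]
    rw [h6, h5, Matrix.mul_smul, Matrix.mul_one, Matrix.smul_mul, ← hC, smul_smul]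
  calc (2 : ℂ) • (C * Cᴴ * C) = C * ((2 : ℂ) • Cᴴ) * C := by simp
    _ = ∑ k, star (c k) • (C * (Y k * (X k)ᵀ) * C) := by
      rw [← h2, Matrix.mul_sum, Matrix.sum_mul]
      simp
    _ = C := by simp only [h3]; rw [← Finset.sum_smul, hc, one_smul]

/-! ### Rigidity of the resource -/

theorem coe_conjTranspose_mul_self (v : Matrix.unitaryGroup (Fin 2) ℂ) :
    (v : Matrix (Fin 2) (Fin 2) ℂ)ᴴ * (v : Matrix (Fin 2) (Fin 2) ℂ) = 1 :=
  Unitary.coe_star_mul_self v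

theorem coe_mul_conjTranspose_self (v : Matrix.unitaryGroup (Fin 2) ℂ) :
    (v : Matrix (Fin 2) (Fin 2) ℂ) * (v : Matrix (Fin 2) (Fin 2) ℂ)ᴴ = 1 :=
  Unitary.coe_mul_star_self v

theorem locallyEquivalent_controlled_eq (u v₁ v₂ w₁ w₂ : Matrix (Fin 2) (Fin 2) ℂ) :
    (v₁ ⊗ₖ v₂) * controlled u * (w₁ ⊗ₖ w₂) =
      (v₁ * Matrix.single 0 0 1 * w₁) ⊗ₖ (v₂ * w₂) +
        (v₁ * Matrix.single 1 1 1 * w₁) ⊗ₖ (v₂ * u * w₂) := by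
  simp only [controlled, Matrix.mul_add, Matrix.add_mul, ← Matrix.mul_kronecker_mul, Matrix.mul_one]

theorem controlled_unitary (u : Matrix.unitaryGroup (Fin 2) ℂ) :
    (controlled (u : Matrix (Fin 2) (Fin 2) ℂ))ᴴ * controlled (u : Matrix (Fin 2) (Fin 2) ℂ) = 1 := by
  simp only [controlled, Matrix.conjTranspose_add, Matrix.conjTranspose_kronecker, Matrix.mul_add,
    Matrix.add_mul, ← Matrix.mul_kronecker_mul, coe_conjTranspose_mul_self]
  simp [← Matrix.add_kronecker]
  rw [← Matrix.one_kronecker_one]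
  congr 1
  ext i j
  fin_cases i <;> fin_cases j <;> simp

theorem IsControlledUnitary.conjTranspose_mul_self {U : TwoQubitOp} (hU : IsControlledUnitary U) :
    Uᴴ * U = 1 := by
  obtain ⟨u, v₁, v₂, w₁, w₂, rfl⟩ := hU
  have h : ∀ v w : Matrix.unitaryGroup (Fin 2) ℂ,
      ((v : Matrix (Fin 2) (Fin 2) ℂ) ⊗ₖ (w : Matrix (Fin 2) (Fin 2) ℂ))ᴴ *
      ((v : Matrix (Fin 2) (Fin 2) ℂ) ⊗ₖ (w : Matrix (Fin 2) (Fin 2) ℂ)) = 1 := by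
    intro v w
    rw [Matrix.conjTranspose_kronecker, ← Matrix.mul_kronecker_mul, coe_conjTranspose_mul_self,
      coe_conjTranspose_mul_self, Matrix.one_kronecker_one]
  rw [Matrix.conjTranspose_mul, Matrix.conjTranspose_mul]
  calc _ = ((w₁ : Matrix (Fin 2) (Fin 2) ℂ) ⊗ₖ (w₂ : Matrix (Fin 2) (Fin 2) ℂ))ᴴ *
        ((controlled (u : Matrix (Fin 2) (Fin 2) ℂ))ᴴ *
        (((v₁ : Matrix (Fin 2) (Fin 2) ℂ) ⊗ₖ (v₂ : Matrix (Fin 2) (Fin 2) ℂ))ᴴ *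
        ((v₁ : Matrix (Fin 2) (Fin 2) ℂ) ⊗ₖ (v₂ : Matrix (Fin 2) (Fin 2) ℂ))) *
        controlled (u : Matrix (Fin 2) (Fin 2) ℂ)) *
        ((w₁ : Matrix (Fin 2) (Fin 2) ℂ) ⊗ₖ (w₂ : Matrix (Fin 2) (Fin 2) ℂ)) := by
          simp only [Matrix.mul_assoc]
    _ = 1 := by rw [h, Matrix.mul_one, controlled_unitary, Matrix.mul_one, h]

/-- The phase gate `diag(1, z)`. -/
def phaseGate (z : ℂ) (hz : ‖z‖ = 1) : Matrix.unitaryGroup (Fin 2) ℂ :=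
  ⟨!![1, 0; 0, z], by
    rw [Matrix.mem_unitaryGroup_iff]
    have : z * (starRingEnd ℂ) z = 1 := by rw [Complex.mul_conj', hz]; simp
    ext i j
    fin_cases i <;> fin_cases j <;> simp [Matrix.mul_apply, Matrix.star_apply, this]⟩

/-- If `u = z • 1`, the controlled operation is the local `diag(1, z) ⊗ 1`. -/
theorem ne_smul_one_of_not_locallyEquivalent_one {U : TwoQubitOp}
    {u : Matrix.unitaryGroup (Fin 2) ℂ} (hU : LocallyEquivalent U (controlled u))
    (hne : ¬ LocallyEquivalent U 1) (z : ℂ) : (u : Matrix (Fin 2) (Fin 2) ℂ) ≠ z • 1 := by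
  intro hz
  have hnorm : ‖z‖ = 1 := by
    have h1 := congrFun (congrFun (coe_conjTranspose_mul_self u) 0) 0
    rw [hz] at h1
    simp at h1
    rw [Complex.mul_conj'] at h1
    have h2 : ‖z‖ ^ 2 = 1 := by exact_mod_cast h1
    nlinarith [norm_nonneg z]
  obtain ⟨v₁, v₂, w₁, w₂, rfl⟩ := hU
  refine hne ⟨v₁ * phaseGate z hnorm, v₂, w₁, w₂, ?_⟩
  have : controlled (u : Matrix (Fin 2) (Fin 2) ℂ) =
      ((phaseGate z hnorm : Matrix.unitaryGroup (Fin 2) ℂ) : Matrix (Fin 2) (Fin 2) ℂ) ⊗ₖ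
        (1 : Matrix (Fin 2) (Fin 2) ℂ) := by
    rw [controlled, hz, Matrix.kronecker_smul, ← Matrix.smul_kronecker, ← Matrix.add_kronecker]
    congr 1
    ext i j
    fin_cases i <;> fin_cases j <;> simp [phaseGate]
  rw [this, ← Matrix.mul_kronecker_mul, Matrix.mul_one, Matrix.mul_one]
  rfl

/-- A controlled unitary that is not local has operator Schmidt rank two: there are functionals
on the two factors with respect to which it is the identity matrix. -/
theorem exists_biorthogonal_functionals {U : TwoQubitOp} (hU : IsControlledUnitary U)
    (hne : ¬ LocallyEquivalent U 1) :
    ∃ α β : Fin 2 → (Matrix (Fin 2) (Fin 2) ℂ →ₗ[ℂ] ℂ),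
      ∀ a b, prodFunctional (α a) (β b) U = (1 : Matrix (Fin 2) (Fin 2) ℂ) a b := by
  obtain ⟨u, hu⟩ := hU
  obtain ⟨β, h00, h0u, h10, h1u⟩ :=
    exists_dual_functionals u (ne_smul_one_of_not_locallyEquivalent_one hu hne)
  obtain ⟨v₁, v₂, w₁, w₂, rfl⟩ := hu
  let s : Matrix.unitaryGroup (Fin 2) ℂ → Matrix.unitaryGroup (Fin 2) ℂ →
      (Matrix (Fin 2) (Fin 2) ℂ →ₗ[ℂ] Matrix (Fin 2) (Fin 2) ℂ) := fun v w =>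
    LinearMap.mulLeft ℂ (v : Matrix (Fin 2) (Fin 2) ℂ)ᴴ ∘ₗ
      LinearMap.mulRight ℂ (w : Matrix (Fin 2) (Fin 2) ℂ)ᴴ
  have hs : ∀ v w (N : Matrix (Fin 2) (Fin 2) ℂ), s v w (v * N * w) = N := by
    intro v w N
    simp only [s, LinearMap.comp_apply, LinearMap.mulLeft_apply, LinearMap.mulRight_apply]
    calc _ = ((v : Matrix (Fin 2) (Fin 2) ℂ)ᴴ * v) * N *
          (w * (w : Matrix (Fin 2) (Fin 2) ℂ)ᴴ) := by simp only [Matrix.mul_assoc]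
      _ = N := by
        rw [coe_conjTranspose_mul_self, coe_mul_conjTranspose_self, Matrix.one_mul, Matrix.mul_one]
  have hs1 : ∀ v w, s v w (v * w) = 1 := fun v w => by simpa using hs v w 1
  -- After the local unitaries are undone, the diagonal entries are dual to the two control
  -- projections, and `β` is dual to `1`, `u`.
  refine ⟨fun a => Matrix.entryLinearMap ℂ ℂ a a ∘ₗ s v₁ w₁, fun b => β b ∘ₗ s v₂ w₂, ?_⟩
  intro a b
  rw [locallyEquivalent_controlled_eq, map_add, prodFunctional_kronecker, prodFunctional_kronecker]
  simp only [LinearMap.comp_apply, hs, hs1]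
  fin_cases a <;> fin_cases b <;> simp [h00, h0u, h10, h1u]

/-- Implementation is required only on normalized states. Linearity of the Kraus form extends it to
all rank-one operators, the zero vector being treated apart. -/
theorem Implements.sum_kraus {m n : ℕ} {P : LOCC 2 2 (2 * m) (2 * n)} {ψ : Fin m × Fin n → ℂ}
    {U : TwoQubitOp} (h : Implements P ψ U) (v : Fin 2 × Fin 2 → ℂ) :
    P.channel (jointState (Matrix.vecMulVec v (star v)) ψ) =
      U * Matrix.vecMulVec v (star v) * Uᴴ := by
  obtain ⟨ι, _, E, F, -, hch⟩ := P.exists_separable_kraus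
  set ρ := Matrix.vecMulVec v (star v) with hρ
  have hpsd : ρ.PosSemidef := Matrix.posSemidef_vecMulVec_self_star v
  rcases eq_or_ne ρ.trace 0 with h0 | h0
  · have : ρ = 0 := hpsd.trace_eq_zero_iff.1 h0
    rw [this, hch, jointState_eq]
    simp
  · have hd : IsDensity (ρ.trace⁻¹ • ρ) :=
      ⟨hpsd.smul (inv_nonneg.2 hpsd.trace_nonneg), by simp [Matrix.trace_smul, h0]⟩
    have := congrArg (fun A => ρ.trace • A) (h _ hd)
    rw [hch, jointState_eq] at this ⊢
    simpa [Finset.smul_sum, smul_smul, h0] using this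

/-- A resource of Schmidt number two with which a nonlocal controlled unitary can be implemented
has a flat Schmidt spectrum. -/
theorem reduced_mul_self_of_implements {U : TwoQubitOp} (hU : IsControlledUnitary U)
    (hne : ¬ LocallyEquivalent U 1) {m n : ℕ} {ψ : Fin m × Fin n → ℂ} (hψ : IsPureState ψ)
    (h2 : schmidtNumber ψ = 2) {P : LOCC 2 2 (2 * m) (2 * n)} (hP : Implements P ψ U) :
    reduced ψ * reduced ψ = ((1 / 2 : ℝ) : ℂ) • reduced ψ := by
  obtain ⟨-, V, -, -, -, -, hV⟩ := exists_schmidt_isometry ψ h2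
  obtain ⟨α, β, hαβ⟩ := exists_biorthogonal_functionals hU hne
  have hUU := hU.conjTranspose_mul_self
  obtain ⟨ι, _, E, F, hcomp, hch⟩ := P.exists_separable_kraus
  have hprop : ∀ k, ∃ c : ℂ, (E k ⊗ₖ F k) * adjoin ψ = c • U := by
    apply kraus_eq_smul_of_unitary U hUU
    intro v
    rw [← hP.sum_kraus v, hch, jointState_eq]
    simp only [Matrix.conjTranspose_mul, Matrix.mul_assoc]
  choose c hc using hprop
  have hsum : ∑ k, star (c k) * c k = 1 := by
    have h1 : ∑ k, ((E k ⊗ₖ F k) * adjoin ψ)ᴴ * ((E k ⊗ₖ F k) * adjoin ψ) = 1 := by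
      rw [← adjoin_isometry hψ]
      conv_rhs => rw [← Matrix.mul_one (adjoin ψ)ᴴ, ← hcomp]
      simp only [Matrix.mul_sum, Matrix.sum_mul, Matrix.conjTranspose_mul, Matrix.mul_assoc]
    simp only [hc, Matrix.conjTranspose_smul, Matrix.smul_mul, Matrix.mul_smul, hUU] at h1
    have h3 := congrFun (congrFun h1 (0, 0)) (0, 0)
    simpa [Matrix.sum_apply, mul_comm] using h3
  -- Completeness gives `∑ (K J)ᴴ K = Jᴴ` over the Kraus operators `K`. Substituting `K J = c U` and
  -- multiplying by `U` isolates the weighted average of the `K`.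
  have hadj : ∑ k, star (c k) • (E k ⊗ₖ F k) = U * (adjoin ψ)ᴴ := by
    have h1 : ∑ k, ((E k ⊗ₖ F k) * adjoin ψ)ᴴ * (E k ⊗ₖ F k) = (adjoin ψ)ᴴ := by
      conv_rhs => rw [← Matrix.mul_one (adjoin ψ)ᴴ, ← hcomp]
      simp only [Matrix.mul_sum, Matrix.conjTranspose_mul, Matrix.mul_assoc]
    rw [← h1, Matrix.mul_sum]
    refine Finset.sum_congr rfl fun k _ => ?_
    rw [hc, Matrix.conjTranspose_smul, Matrix.smul_mul, Matrix.mul_smul, ← Matrix.mul_assoc,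
      mul_eq_one_comm.1 hUU, Matrix.one_mul]
  have hblock : ∀ j l, ∑ k, star (c k) • (block (E k) j ⊗ₖ block (F k) l) =
      star (ψ (j, l)) • U := by
    intro j l
    ext x ⟨a, b⟩
    have h1 := congrFun (congrFun hadj x) (finProdFinEquiv (a, j), finProdFinEquiv (b, l))
    have h3 : (U * (adjoin ψ)ᴴ) x (finProdFinEquiv (a, j), finProdFinEquiv (b, l)) =
        star (ψ (j, l)) * U x (a, b) := by
      simp only [Matrix.mul_apply, Matrix.conjTranspose_apply, adjoin, Matrix.of_apply,
        Equiv.symm_apply_apply, apply_ite star, star_zero, mul_ite, mul_zero, Finset.sum_ite_eq',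
        Finset.mem_univ, if_true, mul_comm]
    rw [h3] at h1
    simpa [Matrix.sum_apply, block] using h1
  have hflat : (2 : ℂ) • (coeffMatrix ψ * (coeffMatrix ψ)ᴴ * coeffMatrix ψ) = coeffMatrix ψ := by
    refine flat_of_dual_families hV.symm
      (fun k => Matrix.of fun j a => α a (block (E k) j))
      (fun k => Matrix.of fun l b => β b (block (F k) l)) c hsum ?_ ?_
    · intro k
      ext a b
      have h1 := congrArg (prodFunctional (α a) (β b)) (hc k)
      rw [kronecker_mul_adjoin] at h1
      simp only [map_sum, map_smul, prodFunctional_kronecker, hαβ] at h1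
      rw [Matrix.smul_apply, ← h1, Finset.sum_comm]
      simp only [Matrix.mul_apply, Matrix.transpose_apply, Matrix.of_apply, coeffMatrix,
        Finset.sum_mul, smul_eq_mul]
      refine Finset.sum_congr rfl fun l _ => Finset.sum_congr rfl fun j _ => ?_
      ring
    · ext l j
      have h1 : ∀ a, ∑ k, star (c k) * (α a (block (E k) j) * β a (block (F k) l)) =
          star (ψ (j, l)) := by
        intro a
        have h3 := congrArg (prodFunctional (α a) (β a)) (hblock j l)
        simpa only [map_sum, map_smul, prodFunctional_kronecker, hαβ, smul_eq_mul,
          Matrix.one_apply_eq, mul_one] using h3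
      -- The factor 2 in the dual relation comes from adding the two diagonal pairings.
      have h4 := congrArg₂ (· + ·) (h1 0) (h1 1)
      simp only [← Finset.sum_add_distrib] at h4
      simp only [Matrix.sum_apply, Matrix.smul_apply, Matrix.mul_apply, Matrix.transpose_apply,
        Matrix.of_apply, Fin.sum_univ_two, smul_eq_mul, Matrix.conjTranspose_apply, coeffMatrix]
      rw [two_mul, ← h4]
      refine Finset.sum_congr rfl fun k _ => ?_
      ring
  have h3 := congrArg (fun A => A * (coeffMatrix ψ)ᴴ) hflat
  simp only [Matrix.smul_mul, Matrix.mul_assoc] at h3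
  have h4 : (2 : ℂ) • (reduced ψ * reduced ψ) = reduced ψ := by
    simpa only [reduced, Matrix.mul_assoc] using h3
  conv_rhs => rw [← h4]
  rw [smul_smul]
  norm_num

/-! ### The three-turn protocol -/

/-- Completion of an incomplete two-outcome measurement with `∑ r, (T r)ᴴ * T r = p` by outcomes
supported on the complement of `p`. -/
def completion {N : ℕ} (T : Fin 2 → Matrix (Fin 2) (Fin N) ℂ) (p : Matrix (Fin N) (Fin N) ℂ) :
    Fin (2 + N) → Matrix (Fin 2) (Fin N) ℂ :=
  Fin.append T fun i => Matrix.single (0 : Fin 2) i (1 : ℂ) * (1 - p)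

/-- The extra outcomes contribute `(1 - p) (∑ |i⟩⟨i|) (1 - p) = 1 - p`. Sending each basis vector to
the same qubit state keeps the output dimension two. -/
theorem completion_complete {N : ℕ} (T : Fin 2 → Matrix (Fin 2) (Fin N) ℂ)
    (p : Matrix (Fin N) (Fin N) ℂ) (hp : pᴴ = p) (hp2 : p * p = p)
    (hT : ∑ r, (T r)ᴴ * T r = p) :
    ∑ r, (completion T p r)ᴴ * completion T p r = 1 := by
  rw [Fin.sum_univ_add]
  simp only [completion, Fin.append_left, Fin.append_right, hT]
  have h1 : ∀ i : Fin N, (Matrix.single (0 : Fin 2) i (1 : ℂ) * (1 - p))ᴴ *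
      (Matrix.single (0 : Fin 2) i (1 : ℂ) * (1 - p)) =
      (1 - p) * Matrix.single i i 1 * (1 - p) := by
    intro i
    have h2 : (Matrix.single (0 : Fin 2) i (1 : ℂ))ᴴ * Matrix.single (0 : Fin 2) i (1 : ℂ) =
        Matrix.single i i 1 := by simp
    rw [Matrix.conjTranspose_mul, Matrix.conjTranspose_sub, Matrix.conjTranspose_one, hp, ← h2]
    simp only [Matrix.mul_assoc]
  have h3 : ∑ i : Fin N, Matrix.single i i (1 : ℂ) = 1 := by
    simpa using Matrix.sum_single_eq_diagonal (fun _ : Fin N => (1 : ℂ))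
  simp only [h1]
  rw [← Matrix.sum_mul, ← Matrix.mul_sum, h3, Matrix.mul_one, Matrix.sub_mul, Matrix.one_mul,
    Matrix.mul_sub, Matrix.mul_one, hp2]
  simp

/-- Alice measures, then Bob, then Alice applies a unitary. The measurements need to be complete
only on the subspaces that contain the image of `J`. -/
theorem exists_three_turn_protocol {a b : ℕ} {κ : Type*} [Fintype κ]
    (J : Matrix (Fin a × Fin b) κ ℂ) (p : Matrix (Fin a) (Fin a) ℂ) (q : Matrix (Fin b) (Fin b) ℂ)
    (hA : pᴴ = p) (hA2 : p * p = p) (hB : qᴴ = q) (hB2 : q * q = q)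
    (hJA : (p ⊗ₖ (1 : Matrix (Fin b) (Fin b) ℂ)) * J = J)
    (hJB : ((1 : Matrix (Fin a) (Fin a) ℂ) ⊗ₖ q) * J = J)
    (T : Fin 2 → Matrix (Fin 2) (Fin a) ℂ) (S : Fin 2 → Fin 2 → Matrix (Fin 2) (Fin b) ℂ)
    (hT : ∑ r, (T r)ᴴ * T r = p) (hS : ∀ r, ∑ t, (S r t)ᴴ * S r t = q)
    (V : Fin 2 → Matrix.unitaryGroup (Fin 2) ℂ) :
    ∃ P : LOCC 2 2 a b, P.turns = 3 ∧ ∀ ρ : Matrix κ κ ℂ, P.channel (J * ρ * Jᴴ) =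
      ∑ r, ∑ t, ((((V t : Matrix (Fin 2) (Fin 2) ℂ) * T r) ⊗ₖ S r t) * J) * ρ *
        ((((V t : Matrix (Fin 2) (Fin 2) ℂ) * T r) ⊗ₖ S r t) * J)ᴴ := by
  let M := completion T p
  -- After an outcome outside the support any continuation will do, since such a branch vanishes on
  -- `J`. `S 0` here and `1` in `V'` are fillers.
  let S' : Fin (2 + a) → Fin 2 → Matrix (Fin 2) (Fin b) ℂ := Fin.append S fun _ => S 0
  have hS' : ∀ r, ∑ t, (S' r t)ᴴ * S' r t = q := by
    intro r
    refine Fin.addCases (fun i => ?_) (fun i => ?_) r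
    · simpa only [S', Fin.append_left] using hS i
    · simpa only [S', Fin.append_right] using hS 0
  let K := fun r => completion (S' r) q
  let V' : Fin (2 + b) → Matrix.unitaryGroup (Fin 2) ℂ := Fin.append V fun _ => 1
  let P : LOCC 2 2 a b :=
    .alice (2 + a) (fun _ => 2) M (completion_complete T p hA hA2 hT) fun r =>
      .bob (2 + b) (fun _ => 2) (K r) (completion_complete (S' r) q hB hB2 (hS' r)) fun t =>
        .alice 1 (fun _ => 2) (fun _ => (V' t : Matrix (Fin 2) (Fin 2) ℂ))
          (by simp [coe_conjTranspose_mul_self]) fun _ => .done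
  refine ⟨P, ?_, ?_⟩
  · have : ∀ N : ℕ, (Finset.univ : Finset (Fin (2 + N))).Nonempty := fun N =>
      ⟨⟨0, by omega⟩, Finset.mem_univ _⟩
    simp only [P, LOCC.turns, Finset.sup_const (this _)]
    simp
  intro ρ
  have hch : P.channel (J * ρ * Jᴴ) =
      ∑ r, ∑ t, ((((V' t : Matrix (Fin 2) (Fin 2) ℂ) * M r) ⊗ₖ K r t) * J) * ρ *
        ((((V' t : Matrix (Fin 2) (Fin 2) ℂ) * M r) ⊗ₖ K r t) * J)ᴴ := by
    simp only [P, LOCC.channel, Finset.univ_unique, Finset.sum_singleton]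
    refine Finset.sum_congr rfl fun r _ => Finset.sum_congr rfl fun t _ => ?_
    have : ((V' t : Matrix (Fin 2) (Fin 2) ℂ) * M r) ⊗ₖ K r t =
        ((V' t : Matrix (Fin 2) (Fin 2) ℂ) ⊗ₖ (1 : Matrix (Fin 2) (Fin 2) ℂ)) *
          (((1 : Matrix (Fin 2) (Fin 2) ℂ) ⊗ₖ K r t) *
            (M r ⊗ₖ (1 : Matrix (Fin b) (Fin b) ℂ))) := by
      simp only [← Matrix.mul_kronecker_mul, Matrix.one_mul, Matrix.mul_one]
    rw [this]
    simp only [Matrix.conjTranspose_mul, Matrix.mul_assoc]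
  have hzA : ∀ (A : Matrix (Fin 2) (Fin a) ℂ) (B : Matrix (Fin 2) (Fin b) ℂ),
      ((A * (1 - p)) ⊗ₖ B) * J = 0 := by
    intro A B
    have : (A * (1 - p)) ⊗ₖ B =
        (A ⊗ₖ B) * (1 - p ⊗ₖ (1 : Matrix (Fin b) (Fin b) ℂ)) := by
      have h1 : (1 - p) ⊗ₖ (1 : Matrix (Fin b) (Fin b) ℂ) =
          1 - p ⊗ₖ (1 : Matrix (Fin b) (Fin b) ℂ) := by
        rw [eq_sub_iff_add_eq, ← Matrix.add_kronecker, sub_add_cancel, Matrix.one_kronecker_one]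
      rw [← h1, ← Matrix.mul_kronecker_mul, Matrix.mul_one]
    rw [this, Matrix.mul_assoc, Matrix.sub_mul, Matrix.one_mul, hJA, sub_self, Matrix.mul_zero]
  have hzB : ∀ (A : Matrix (Fin 2) (Fin a) ℂ) (B : Matrix (Fin 2) (Fin b) ℂ),
      (A ⊗ₖ (B * (1 - q))) * J = 0 := by
    intro A B
    have : A ⊗ₖ (B * (1 - q)) =
        (A ⊗ₖ B) * (1 - (1 : Matrix (Fin a) (Fin a) ℂ) ⊗ₖ q) := by
      have h1 : (1 : Matrix (Fin a) (Fin a) ℂ) ⊗ₖ (1 - q) =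
          1 - (1 : Matrix (Fin a) (Fin a) ℂ) ⊗ₖ q := by
        rw [eq_sub_iff_add_eq, ← Matrix.kronecker_add, sub_add_cancel, Matrix.one_kronecker_one]
      rw [← h1, ← Matrix.mul_kronecker_mul, Matrix.mul_one]
    rw [this, Matrix.mul_assoc, Matrix.sub_mul, Matrix.one_mul, hJB, sub_self, Matrix.mul_zero]
  rw [hch, Fin.sum_univ_add]
  simp only [Fin.sum_univ_add (a := 2) (b := b), M, K, S', V', completion, Fin.append_left,
    Fin.append_right, ← Matrix.mul_assoc, hzA, hzB]
  simp

/-- The operator `1 ⊗ p` on `ℂ² ⊗ ℂᵐ ≅ ℂ²ᵐ`. -/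
def ancillaOp {m : ℕ} (p : Matrix (Fin m) (Fin m) ℂ) : Matrix (Fin (2 * m)) (Fin (2 * m)) ℂ :=
  ((1 : Matrix (Fin 2) (Fin 2) ℂ) ⊗ₖ p).submatrix finProdFinEquiv.symm finProdFinEquiv.symm

theorem ancillaOp_conjTranspose {m : ℕ} {p : Matrix (Fin m) (Fin m) ℂ} (h : pᴴ = p) :
    (ancillaOp p)ᴴ = ancillaOp p := by
  rw [ancillaOp, Matrix.conjTranspose_submatrix, Matrix.conjTranspose_kronecker, h,
    Matrix.conjTranspose_one]

theorem ancillaOp_mul_self {m : ℕ} {p : Matrix (Fin m) (Fin m) ℂ} (h : p * p = p) :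
    ancillaOp p * ancillaOp p = ancillaOp p := by
  rw [ancillaOp, Matrix.submatrix_mul_equiv, ← Matrix.mul_kronecker_mul, h, Matrix.one_mul]

theorem ancillaOp_alice_mul_adjoin {m n : ℕ} {p : Matrix (Fin m) (Fin m) ℂ}
    {ψ : Fin m × Fin n → ℂ} (h : p * coeffMatrix ψ = coeffMatrix ψ) :
    (ancillaOp p ⊗ₖ (1 : Matrix (Fin (2 * n)) (Fin (2 * n)) ℂ)) * adjoin ψ = adjoin ψ := by
  ext ⟨x, y⟩ ⟨a, b⟩
  obtain ⟨⟨i, j⟩, rfl⟩ := finProdFinEquiv.surjective x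
  obtain ⟨⟨k, l⟩, rfl⟩ := finProdFinEquiv.surjective y
  have h1 : ∑ j', p j j' * ψ (j', l) = ψ (j, l) := by
    simpa [Matrix.mul_apply, coeffMatrix] using congrFun (congrFun h j) l
  simp only [Matrix.mul_apply, Fintype.sum_prod_type, sum_fin_two_mul, adjoin, Matrix.of_apply,
    Equiv.symm_apply_apply, Matrix.kroneckerMap_apply, ancillaOp, Matrix.submatrix_apply,
    Matrix.one_apply, EmbeddingLike.apply_eq_iff_eq, Prod.mk.injEq]
  fin_cases a <;> fin_cases b <;> fin_cases i <;> fin_cases k <;>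
    simp [Fin.sum_univ_two, h1]

theorem ancillaOp_bob_mul_adjoin {m n : ℕ} {p : Matrix (Fin n) (Fin n) ℂ}
    {ψ : Fin m × Fin n → ℂ} (h : p * (coeffMatrix ψ)ᵀ = (coeffMatrix ψ)ᵀ) :
    ((1 : Matrix (Fin (2 * m)) (Fin (2 * m)) ℂ) ⊗ₖ ancillaOp p) * adjoin ψ = adjoin ψ := by
  ext ⟨x, y⟩ ⟨a, b⟩
  obtain ⟨⟨i, j⟩, rfl⟩ := finProdFinEquiv.surjective x
  obtain ⟨⟨k, l⟩, rfl⟩ := finProdFinEquiv.surjective y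
  have h1 : ∑ l', p l l' * ψ (j, l') = ψ (j, l) := by
    simpa [Matrix.mul_apply, coeffMatrix] using congrFun (congrFun h l) j
  simp only [Matrix.mul_apply, Fintype.sum_prod_type, sum_fin_two_mul, adjoin, Matrix.of_apply,
    Equiv.symm_apply_apply, Matrix.kroneckerMap_apply, ancillaOp, Matrix.submatrix_apply,
    Matrix.one_apply, EmbeddingLike.apply_eq_iff_eq, Prod.mk.injEq]
  fin_cases a <;> fin_cases b <;> fin_cases i <;> fin_cases k <;>
    simp [Fin.sum_univ_two, h1]

/-- The local operator on `ℂ² ⊗ ℂᵐ ≅ ℂ²ᵐ` with prescribed blocks. -/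
def ofBlocks {m : ℕ} (T : Fin m → Matrix (Fin 2) (Fin 2) ℂ) : Matrix (Fin 2) (Fin (2 * m)) ℂ :=
  Matrix.of fun o x => T (finProdFinEquiv.symm x).2 o (finProdFinEquiv.symm x).1

@[simp]
theorem block_ofBlocks {m : ℕ} (T : Fin m → Matrix (Fin 2) (Fin 2) ℂ) (j : Fin m) :
    block (ofBlocks T) j = T j := by
  ext o a
  simp only [block, ofBlocks, Matrix.submatrix_apply, Matrix.of_apply, Equiv.symm_apply_apply, id]

theorem ofBlocks_sum_eq_ancillaOp {m : ℕ} (T : Fin 2 → Fin m → Matrix (Fin 2) (Fin 2) ℂ)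
    (p : Matrix (Fin m) (Fin m) ℂ)
    (h : ∀ j j', ∑ r, (T r j)ᴴ * T r j' = p j j' • (1 : Matrix (Fin 2) (Fin 2) ℂ)) :
    ∑ r, (ofBlocks (T r))ᴴ * ofBlocks (T r) = ancillaOp p := by
  ext x y
  have h1 := congrFun (congrFun (h (finProdFinEquiv.symm x).2 (finProdFinEquiv.symm y).2)
    (finProdFinEquiv.symm x).1) (finProdFinEquiv.symm y).1
  simp only [Matrix.sum_apply, Matrix.mul_apply, Matrix.conjTranspose_apply, Matrix.smul_apply,
    smul_eq_mul] at h1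
  simp only [Matrix.sum_apply, Matrix.mul_apply, Matrix.conjTranspose_apply, ofBlocks,
    Matrix.of_apply, ancillaOp, Matrix.submatrix_apply, Matrix.kroneckerMap_apply]
  rw [h1, mul_comm]

/-- A maximally entangled state of Schmidt number two, up to local isometries, is the standard
Bell state. -/
theorem exists_bell_form {m n : ℕ} {ψ : Fin m × Fin n → ℂ} (hψ : IsPureState ψ)
    (h2 : schmidtNumber ψ = 2) (hme : IsMaximallyEntangled ψ) :
    ∃ (P : Matrix (Fin m) (Fin 2) ℂ) (Q : Matrix (Fin 2) (Fin n) ℂ) (s : ℂ),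
      Pᴴ * P = 1 ∧ Q * Qᴴ = 1 ∧ star s = s ∧ s * s = 1 / 2 ∧ coeffMatrix ψ = s • (P * Q) := by
  obtain ⟨e, P, hinj, hrange, hPP, hR, hPC⟩ := exists_schmidt_isometry ψ h2
  have hpos : ∀ i, 0 ≤ (reduced_isHermitian ψ).eigenvalues i :=
    fun i => (Matrix.posSemidef_self_mul_conjTranspose (coeffMatrix ψ)).eigenvalues_nonneg i
  have heq : (reduced_isHermitian ψ).eigenvalues (e 0) =
      (reduced_isHermitian ψ).eigenvalues (e 1) :=
    (Real.sqrt_inj (hpos _) (hpos _)).1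
      (hme _ _ ((hrange _).2 ⟨0, rfl⟩) ((hrange _).2 ⟨1, rfl⟩))
  set t := (reduced_isHermitian ψ).eigenvalues (e 0) with ht
  have hdiag : (fun j => (((reduced_isHermitian ψ).eigenvalues (e j) : ℝ) : ℂ)) =
      fun _ => (t : ℂ) := by
    funext j
    fin_cases j
    · rfl
    · exact congrArg _ heq.symm
  rw [hdiag] at hR
  have hR' : reduced ψ = (t : ℂ) • (P * Pᴴ) := by
    rw [hR, ← Matrix.smul_one_eq_diagonal]
    simp
  have htr : (reduced ψ).trace = 1 := by
    have h3 : ∀ z : ℂ, z * star z = ((‖z‖ ^ 2 : ℝ) : ℂ) := fun z => by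
      simpa using Complex.mul_conj' z
    simp only [reduced, Matrix.trace, Matrix.diag_apply, Matrix.mul_apply, coeffMatrix,
      Matrix.conjTranspose_apply, Matrix.of_apply, h3]
    rw [← Fintype.sum_prod_type (f := fun x => (((‖ψ x‖ ^ 2 : ℝ)) : ℂ))]
    rw [IsPureState] at hψ
    exact_mod_cast hψ
  have ht2 : t = 1 / 2 := by
    rw [hR', Matrix.trace_smul, Matrix.trace_mul_comm, hPP, Matrix.trace_one] at htr
    simp at htr
    have : t * 2 = 1 := by
      have h5 : ((t * 2 : ℝ) : ℂ) = 1 := by push_cast; exact htr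
      exact_mod_cast h5
    linarith
  have hs : ((Real.sqrt 2 : ℝ) : ℂ) * ((Real.sqrt 2 : ℝ) : ℂ) = 2 := by
    norm_cast
    simp
  have hs0 : ((Real.sqrt 2 : ℝ) : ℂ) ≠ 0 := by
    intro h; rw [h] at hs; norm_num at hs
  refine ⟨P, ((Real.sqrt 2 : ℝ) : ℂ) • (Pᴴ * coeffMatrix ψ), ((Real.sqrt 2 : ℝ) : ℂ)⁻¹, hPP, ?_, ?_,
    ?_, ?_⟩
  · have h1 : (Pᴴ * coeffMatrix ψ) * (Pᴴ * coeffMatrix ψ)ᴴ = Pᴴ * reduced ψ * P := by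
      simp [reduced, Matrix.conjTranspose_mul, Matrix.mul_assoc]
    rw [Matrix.conjTranspose_smul, Matrix.smul_mul, Matrix.mul_smul, smul_smul, h1, hR',
      Matrix.mul_smul, Matrix.smul_mul]
    have h4 : Pᴴ * (P * Pᴴ) * P = 1 := by
      rw [← Matrix.mul_assoc, hPP, Matrix.one_mul, hPP]
    rw [h4, smul_smul, ht2]
    simp [hs]
  · simp
  · rw [← mul_inv, hs]; norm_num
  · rw [Matrix.mul_smul, smul_smul, inv_mul_cancel₀ hs0, one_smul, hPC]

/-- Bilinear expansion reduces a branch of the protocol to overlaps of the resource with the local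
measurement vectors. -/
theorem sum_smul_kronecker {m n : ℕ} (ψ : Fin m × Fin n → ℂ) (x : Fin 2 → Fin m → ℂ)
    (y : Fin 2 → Fin n → ℂ) (A B : Fin 2 → Matrix (Fin 2) (Fin 2) ℂ) :
    ∑ j, ∑ l, ψ (j, l) • ((∑ o, x o j • A o) ⊗ₖ (∑ a, y a l • B a)) =
      ∑ o, ∑ a, (∑ j, ∑ l, ψ (j, l) * x o j * y a l) • (A o ⊗ₖ B a) := by
  ext p q
  simp only [Matrix.sum_apply, Matrix.smul_apply, Matrix.kroneckerMap_apply, smul_eq_mul,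
    Fin.sum_univ_two, Matrix.add_apply, Finset.sum_mul, ← Finset.sum_add_distrib]
  refine Finset.sum_congr rfl fun j _ => Finset.sum_congr rfl fun l _ => ?_
  ring

/-- A maximally entangled state of Schmidt number two suffices for every controlled unitary. -/
theorem exists_protocol_of_maximallyEntangled {U : TwoQubitOp} (hU : IsControlledUnitary U)
    {m n : ℕ} {ψ : Fin m × Fin n → ℂ} (hψ : IsPureState ψ) (h2 : schmidtNumber ψ = 2)
    (hme : IsMaximallyEntangled ψ) :
    ∃ P : LOCC 2 2 (2 * m) (2 * n), P.turns = 3 ∧ Implements P ψ U := by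
  obtain ⟨P, Q, s, hP, hQ, hs, hss, hC⟩ := exists_bell_form hψ h2 hme
  obtain ⟨u, v₁, v₂, w₁, w₂, rfl⟩ := hU
  set W : Matrix (Fin 2) (Fin 2) ℂ := w₁.1 with hW
  have hWW : Wᴴ * W = 1 := coe_conjTranspose_mul_self w₁
  let G : Fin 2 → Matrix.unitaryGroup (Fin 2) ℂ := ![v₂ * w₂, v₂ * u * w₂]
  let sgn : Fin 2 → Fin 2 → ℂ := fun t a => if t = 1 ∧ a = 1 then -1 else 1
  -- Alice's outcome `r` is the difference between the control bit `o` and the Schmidt label of her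
  -- half; Bob's label is then `o + r`.
  let T : Fin 2 → Fin m → Matrix (Fin 2) (Fin 2) ℂ := fun r j =>
    ∑ o, star (P j (o + r)) • (Matrix.single o o 1 * W)
  -- Knowing `r`, Bob applies `G a` on label `a + r` and projects his half onto the Fourier vector
  -- `t`. The Fourier normalization is again `s`, as `s * s = 1 / 2`.
  let S : Fin 2 → Fin 2 → Fin n → Matrix (Fin 2) (Fin 2) ℂ := fun r t l =>
    ∑ a, (s * sgn t a * star (Q (a + r) l)) • (G a : Matrix (Fin 2) (Fin 2) ℂ)
  -- For `t = 1` the gate `diag(1, -1)` cancels the sign left on control value 1.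
  let V : Fin 2 → Matrix.unitaryGroup (Fin 2) ℂ := ![v₁, v₁ * phaseGate (-1) (by simp)]
  have hQ' : ∀ l l', (Qᵀ * Qᵀᴴ) l l' = Q 0 l * star (Q 0 l') + Q 1 l * star (Q 1 l') := by
    intro l l'
    simp [Matrix.mul_apply, Fin.sum_univ_two]
  have hQT : Qᵀᴴ * Qᵀ = 1 := by
    have := congrArg Matrix.transpose hQ
    rw [Matrix.transpose_mul, Matrix.transpose_one] at this
    exact this
  have hT : ∑ r, (ofBlocks (T r))ᴴ * ofBlocks (T r) = ancillaOp (P * Pᴴ) := by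
    apply ofBlocks_sum_eq_ancillaOp
    intro j j'
    -- The two outcomes exchange the weights of the control projections, so their sum is scalar on
    -- the qubit.
    have hproj : ∀ x y : ℂ, Wᴴ *
        (x • Matrix.single 0 0 (1 : ℂ) + y • Matrix.single 1 1 1) * W +
        Wᴴ *
        (y • Matrix.single 0 0 1 + x • Matrix.single 1 1 1) * W = (x + y) • 1 := by
      intro x y
      have : (x • Matrix.single 0 0 (1 : ℂ) + y • Matrix.single 1 1 1) +
          (y • Matrix.single 0 0 1 + x • Matrix.single 1 1 1) =
          (x + y) • (1 : Matrix (Fin 2) (Fin 2) ℂ) := by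
        ext i j
        fin_cases i <;> fin_cases j <;> simp [add_comm]
      rw [← Matrix.add_mul, ← Matrix.mul_add, this, Matrix.mul_smul, Matrix.mul_one,
        Matrix.smul_mul, hWW]
    have hTT : ∀ r, (T r j)ᴴ * T r j' = Wᴴ *
        ((P j (0 + r) * star (P j' (0 + r))) • Matrix.single 0 0 1 +
          (P j (1 + r) * star (P j' (1 + r))) • Matrix.single 1 1 1) * W := by
      intro r
      have : ∀ i, T r i = (star (P i (0 + r)) • Matrix.single 0 0 1 +
          star (P i (1 + r)) • Matrix.single 1 1 1) * W := by
        intro i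
        simp only [T, Fin.sum_univ_two, Matrix.add_mul, Matrix.smul_mul]
      rw [this, this, Matrix.conjTranspose_mul]
      simp only [← Matrix.mul_assoc]
      congr 1
      rw [Matrix.mul_assoc]
      congr 1
      simp [Matrix.add_mul, Matrix.mul_add, mul_comm]
    rw [Fin.sum_univ_two, hTT, hTT]
    have h := hproj (P j 0 * star (P j' 0)) (P j 1 * star (P j' 1))
    simp only [zero_add, add_zero, show (1 + 1 : Fin 2) = 0 from rfl]
    rw [h]
    simp [Matrix.mul_apply, Fin.sum_univ_two]
  have hS : ∀ r, ∑ t, (ofBlocks (S r t))ᴴ * ofBlocks (S r t) = ancillaOp (Qᵀ * Qᵀᴴ) := by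
    intro r
    apply ofBlocks_sum_eq_ancillaOp
    intro l l'
    rw [hQ']
    have hG0 := coe_conjTranspose_mul_self (G 0)
    have hG1 := coe_conjTranspose_mul_self (G 1)
    have hr : Q 0 l * star (Q 0 l') + Q 1 l * star (Q 1 l') =
        Q (0 + r) l * star (Q (0 + r) l') + Q (1 + r) l * star (Q (1 + r) l') := by
      fin_cases r
      · simp
      · simp [add_comm]
    rw [hr]
    -- The parallelogram identity: summing over `t` cancels the cross terms between `G 0` and `G 1`.
    have hsum : ∀ X Y X' Y' : Matrix (Fin 2) (Fin 2) ℂ, (X + Y)ᴴ * (X' + Y') +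
        (X - Y)ᴴ * (X' - Y') = (2 : ℂ) • (Xᴴ * X' + Yᴴ * Y') := by
      intro X Y X' Y'
      rw [Matrix.conjTranspose_add, Matrix.conjTranspose_sub, two_smul]
      noncomm_ring
    have hS0 : ∀ l, S r 0 l = (s * star (Q (0 + r) l)) • (G 0 : Matrix (Fin 2) (Fin 2) ℂ) +
        (s * star (Q (1 + r) l)) • (G 1 : Matrix (Fin 2) (Fin 2) ℂ) := by
      intro l
      simp [S, sgn, Fin.sum_univ_two]
    have hS1 : ∀ l, S r 1 l = (s * star (Q (0 + r) l)) • (G 0 : Matrix (Fin 2) (Fin 2) ℂ) -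
        (s * star (Q (1 + r) l)) • (G 1 : Matrix (Fin 2) (Fin 2) ℂ) := by
      intro l
      simp [S, sgn, Fin.sum_univ_two, sub_eq_add_neg]
    rw [Fin.sum_univ_two, hS0, hS0, hS1, hS1, hsum]
    simp only [Matrix.conjTranspose_smul, Matrix.smul_mul, Matrix.mul_smul, hG0, hG1, smul_smul,
      ← add_smul, star_mul', star_star, hs]
    congr 1
    linear_combination (2 * (Q (0 + r) l * star (Q (0 + r) l') +
      Q (1 + r) l * star (Q (1 + r) l'))) * hss
  have hJA := ancillaOp_alice_mul_adjoin (p := P * Pᴴ) (ψ := ψ) (by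
    rw [hC, Matrix.mul_smul, Matrix.mul_assoc, ← Matrix.mul_assoc Pᴴ, hP, Matrix.one_mul])
  have hJB := ancillaOp_bob_mul_adjoin (p := Qᵀ * Qᵀᴴ) (ψ := ψ) (by
    rw [hC, Matrix.transpose_smul, Matrix.mul_smul, Matrix.transpose_mul, Matrix.mul_assoc,
      ← Matrix.mul_assoc Qᵀᴴ, hQT, Matrix.one_mul])
  obtain ⟨L, hL, hch⟩ := exists_three_turn_protocol (adjoin ψ) _ _
    (ancillaOp_conjTranspose (p := P * Pᴴ) (by simp))
    (ancillaOp_mul_self (by rw [Matrix.mul_assoc, ← Matrix.mul_assoc Pᴴ, hP, Matrix.one_mul]))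
    (ancillaOp_conjTranspose (p := Qᵀ * Qᵀᴴ) (by simp [Matrix.conjTranspose_mul]))
    (ancillaOp_mul_self (by rw [Matrix.mul_assoc, ← Matrix.mul_assoc Qᵀᴴ, hQT, Matrix.one_mul]))
    hJA hJB _ _ hT hS V
  refine ⟨L, hL, fun ρ _ => ?_⟩
  -- Both labels are shifted by the same `r`, so the perfect correlation `o = a` survives.
  have hcoef : ∀ r o a, ∑ j, ∑ l, ψ (j, l) * star (P j (o + r)) * star (Q (a + r) l) =
      if o = a then s else 0 := by
    intro r o a
    have h1 : Pᴴ * coeffMatrix ψ * Qᴴ = s • 1 := by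
      rw [hC, Matrix.mul_smul, Matrix.smul_mul, ← Matrix.mul_assoc, hP, Matrix.one_mul, hQ]
    have h3 := congrFun (congrFun h1 (o + r)) (a + r)
    rw [Finset.sum_comm]
    simp only [Matrix.mul_apply, Matrix.conjTranspose_apply, Matrix.smul_apply, Matrix.one_apply,
      add_left_inj, Finset.sum_mul, smul_eq_mul, mul_ite, mul_one, mul_zero] at h3
    rw [← h3]
    refine Finset.sum_congr rfl fun l _ => Finset.sum_congr rfl fun j _ => ?_
    simp only [coeffMatrix, Matrix.of_apply]
    ring
  have hbr : ∀ r t, (ofBlocks (T r) ⊗ₖ ofBlocks (S r t)) * adjoin ψ =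
      (1 / 2 : ℂ) • ((Matrix.single 0 0 1 * W) ⊗ₖ (G 0 : Matrix (Fin 2) (Fin 2) ℂ) +
        sgn t 1 • ((Matrix.single 1 1 1 * W) ⊗ₖ (G 1 : Matrix (Fin 2) (Fin 2) ℂ))) := by
    intro r t
    rw [kronecker_mul_adjoin]
    simp only [block_ofBlocks, T, S]
    rw [sum_smul_kronecker]
    have h1 : ∀ o a, ∑ j, ∑ l, ψ (j, l) * star (P j (o + r)) *
        (s * sgn t a * star (Q (a + r) l)) = s * sgn t a * if o = a then s else 0 := by
      intro o a
      rw [← hcoef r o a]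
      simp only [Finset.mul_sum]
      refine Finset.sum_congr rfl fun j _ => Finset.sum_congr rfl fun l _ => ?_
      ring
    simp only [h1, Fin.sum_univ_two]
    have h4 : s * sgn t 1 * s = 1 / 2 * sgn t 1 := by rw [← hss]; ring
    have h5 : s * sgn t 0 * s = 1 / 2 := by simp [sgn, hss]
    simp [smul_smul, smul_add, h4, h5]
  have hUt : ∀ r t, (((V t : Matrix (Fin 2) (Fin 2) ℂ) * ofBlocks (T r)) ⊗ₖ ofBlocks (S r t)) *
      adjoin ψ = (1 / 2 : ℂ) • (((v₁ : Matrix (Fin 2) (Fin 2) ℂ) ⊗ₖ v₂) *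
        controlled u * (W ⊗ₖ w₂)) := by
    intro r t
    have h1 : ((V t : Matrix (Fin 2) (Fin 2) ℂ) * ofBlocks (T r)) ⊗ₖ ofBlocks (S r t) =
        ((V t : Matrix (Fin 2) (Fin 2) ℂ) ⊗ₖ (1 : Matrix (Fin 2) (Fin 2) ℂ)) *
          (ofBlocks (T r) ⊗ₖ ofBlocks (S r t)) := by
      rw [← Matrix.mul_kronecker_mul, Matrix.one_mul]
    have hV0 : (V t : Matrix (Fin 2) (Fin 2) ℂ) * (Matrix.single 0 0 1 * W) =
        v₁.1 * Matrix.single 0 0 1 * W := by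
      fin_cases t
      · simp [V, Matrix.mul_assoc]
      · have : (phaseGate (-1) (by simp) : Matrix (Fin 2) (Fin 2) ℂ) * Matrix.single 0 0 1 =
            Matrix.single 0 0 1 := by
          ext i j; fin_cases i <;> fin_cases j <;> simp [phaseGate, Matrix.mul_apply]
        simp only [← Matrix.mul_assoc]
        congr 1
        simpa [V, Matrix.mul_assoc] using congrArg _ this
    have hV1 : sgn t 1 • ((V t : Matrix (Fin 2) (Fin 2) ℂ) * (Matrix.single 1 1 1 * W)) =
        v₁.1 * Matrix.single 1 1 1 * W := by
      fin_cases t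
      · simp [V, sgn, Matrix.mul_assoc]
      · have : (phaseGate (-1) (by simp) : Matrix (Fin 2) (Fin 2) ℂ) * Matrix.single 1 1 1 =
            -Matrix.single 1 1 1 := by
          ext i j; fin_cases i <;> fin_cases j <;> simp [phaseGate, Matrix.mul_apply]
        simp only [← Matrix.mul_assoc, ← Matrix.smul_mul]
        congr 1
        simp [V, sgn, Matrix.mul_assoc, this]
    rw [h1, Matrix.mul_assoc, hbr, locallyEquivalent_controlled_eq, Matrix.mul_smul, Matrix.mul_add,
      Matrix.mul_smul, ← Matrix.mul_kronecker_mul, ← Matrix.mul_kronecker_mul, hV0,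
      ← Matrix.smul_kronecker, hV1, Matrix.one_mul, Matrix.one_mul]
    rfl
  -- Four branches, each equal to `U / 2`, give total weight `4 · 1/4 = 1`.
  rw [jointState_eq, hch]
  simp only [hUt, Fin.sum_univ_two, Matrix.conjTranspose_smul, Matrix.smul_mul, Matrix.mul_smul,
    smul_smul, ← add_smul]
  norm_num

/-! ### States with a two-dimensional Schmidt spectrum -/

theorem schmidtNumber_eq_rank {A B : Type*} [Fintype A] [DecidableEq A] [Fintype B]
    (ψ : A × B → ℂ) : schmidtNumber ψ = (coeffMatrix ψ).rank := by
  have hpos : ∀ i, 0 ≤ (reduced_isHermitian ψ).eigenvalues i :=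
    fun i => (Matrix.posSemidef_self_mul_conjTranspose (coeffMatrix ψ)).eigenvalues_nonneg i
  rw [← Matrix.rank_self_mul_conjTranspose, ← reduced,
    (reduced_isHermitian ψ).rank_eq_card_non_zero_eigs, schmidtNumber, Nat.card_eq_fintype_card]
  refine Fintype.card_congr (Equiv.subtypeEquivRight fun i => ?_)
  rw [schmidtCoeff, Ne, Real.sqrt_eq_zero (hpos i)]

theorem schmidtNumber_of_reduced_eq {A B : Type*} [Fintype A] [DecidableEq A] [Fintype B]
    (ψ : A × B → ℂ) (h : reduced ψ = ((1 / 2 : ℝ) : ℂ) • 1) :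
    schmidtNumber ψ = Fintype.card A := by
  rw [schmidtNumber_eq_rank, ← Matrix.rank_self_mul_conjTranspose, ← reduced, h,
    Matrix.rank_of_isUnit]
  exact IsUnit.of_mul_eq_one ((2 : ℂ) • 1) (by simp [smul_smul])

theorem entanglement_of_reduced_eq {A B : Type*} [Fintype A] [DecidableEq A] [Fintype B]
    (ψ : A × B → ℂ) (h : reduced ψ = ((1 / 2 : ℝ) : ℂ) • 1) (hA : Fintype.card A = 2) :
    IsMaximallyEntangled ψ ∧ entanglement ψ = 1 := by
  refine maximallyEntangled_of_reduced ψ ?_ ((schmidtNumber_of_reduced_eq ψ h).trans hA)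
  rw [h]
  simp

theorem trace_mul_self_eq_sum_eigenvalues {A : Type*} [Fintype A] [DecidableEq A]
    {R : Matrix A A ℂ} (hR : R.IsHermitian) :
    (R * R).trace = ((∑ i, hR.eigenvalues i ^ 2 : ℝ) : ℂ) := by
  let V : Matrix A A ℂ := hR.eigenvectorUnitary
  let D : Matrix A A ℂ := Matrix.diagonal (fun i => ((hR.eigenvalues i : ℝ) : ℂ))
  have hV : Vᴴ * V = 1 := Unitary.coe_star_mul_self hR.eigenvectorUnitary
  have hspec : R = V * D * Vᴴ := by
    have := hR.spectral_theorem
    rw [Unitary.conjStarAlgAut_apply] at this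
    exact this
  have h1 : R * R = V * (D * D * Vᴴ) := by
    calc R * R = (V * D * Vᴴ) * (V * D * Vᴴ) := congrArg₂ (· * ·) hspec hspec
      _ = V * (D * (Vᴴ * V) * D * Vᴴ) := by simp only [Matrix.mul_assoc]
      _ = _ := by rw [hV, Matrix.mul_one]
  rw [h1, Matrix.trace_mul_comm, Matrix.mul_assoc, hV, Matrix.mul_one]
  simp [D, Matrix.trace, sq]

/-- The spectrum of a state of Schmidt number at most two is a binary distribution. -/
theorem exists_binEntropy {A B : Type*} [Fintype A] [DecidableEq A] [Fintype B]
    (ψ : A × B → ℂ) (htr : (reduced ψ).trace = 1) (h2 : schmidtNumber ψ ≤ 2) :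
    ∃ x : ℝ, 0 ≤ x ∧ x ≤ 1 ∧ entanglement ψ = Real.binEntropy x / Real.log 2 ∧
      (reduced ψ * reduced ψ).trace = ((x ^ 2 + (1 - x) ^ 2 : ℝ) : ℂ) := by
  classical
  set ev := (reduced_isHermitian ψ).eigenvalues with hev
  have hpos : ∀ i, 0 ≤ ev i :=
    fun i => (Matrix.posSemidef_self_mul_conjTranspose (coeffMatrix ψ)).eigenvalues_nonneg i
  have hsum : ∑ i, ev i = 1 := by
    rw [(reduced_isHermitian ψ).trace_eq_sum_eigenvalues] at htr
    have h1 : ((∑ i, ev i : ℝ) : ℂ) = 1 := by push_cast; exact htr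
    exact_mod_cast h1
  have hcard : (Finset.univ.filter fun i => ev i ≠ 0).card ≤ 2 := by
    rw [schmidtNumber_eq_rank, ← Matrix.rank_self_mul_conjTranspose, ← reduced,
      (reduced_isHermitian ψ).rank_eq_card_non_zero_eigs, Fintype.card_subtype] at h2
    exact h2
  have hent : entanglement ψ = (∑ i, Real.negMulLog (ev i)) / Real.log 2 := by
    rw [entanglement, ← Finset.sum_neg_distrib, Finset.sum_div]
    refine Finset.sum_congr rfl fun i _ => ?_
    rw [schmidtCoeff, Real.sq_sqrt (hpos i), Real.logb, Real.negMulLog]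
    ring
  -- Entropy and purity are both spectral sums of functions vanishing at 0, so one `x` serves both.
  suffices h : ∃ x : ℝ, 0 ≤ x ∧ x ≤ 1 ∧
      ∀ f : ℝ → ℝ, f 0 = 0 → ∑ i, f (ev i) = f x + f (1 - x) by
    obtain ⟨x, h0, h1, hf⟩ := h
    refine ⟨x, h0, h1, ?_, ?_⟩
    · rw [hent, hf _ Real.negMulLog_zero, Real.binEntropy_eq_negMulLog_add_negMulLog_one_sub]
    · rw [trace_mul_self_eq_sum_eigenvalues (reduced_isHermitian ψ), ← hev,
        hf (fun y => y ^ 2) (by norm_num)]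
  set s := Finset.univ.filter fun i => ev i ≠ 0 with hs
  have hfs : ∀ f : ℝ → ℝ, f 0 = 0 → ∑ i, f (ev i) = ∑ i ∈ s, f (ev i) := by
    intro f hf
    symm
    apply Finset.sum_subset (Finset.subset_univ _)
    intro i _ hi
    have : ev i = 0 := by simpa [hs] using hi
    rw [this, hf]
  have hsum' : ∑ i ∈ s, ev i = 1 := by rw [← hsum]; exact (hfs (fun y => y) rfl).symm
  obtain h0 | h1 | h2 : s.card = 0 ∨ s.card = 1 ∨ s.card = 2 := by omega
  · rw [Finset.card_eq_zero] at h0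
    rw [h0] at hsum'
    simp at hsum'
  · obtain ⟨i, hi⟩ := Finset.card_eq_one.1 h1
    rw [hi, Finset.sum_singleton] at hsum'
    refine ⟨1, by norm_num, le_rfl, fun f hf => ?_⟩
    rw [hfs f hf, hi, Finset.sum_singleton, hsum', sub_self, hf, add_zero]
  · obtain ⟨i, j, hij, hi⟩ := Finset.card_eq_two.1 h2
    rw [hi, Finset.sum_pair hij] at hsum'
    refine ⟨ev i, hpos i, by linarith [hpos j], fun f hf => ?_⟩
    rw [hfs f hf, hi, Finset.sum_pair hij, ← hsum', add_sub_cancel_left]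

/-! ### Single-qubit unitaries -/

/-- Every single-qubit unitary is a phase times an element of `SU(2)`. -/
theorem exists_phase_su2 (u : Matrix.unitaryGroup (Fin 2) ℂ) :
    ∃ g a b : ℂ, g * star g = 1 ∧ a * star a + b * star b = 1 ∧
      (u : Matrix (Fin 2) (Fin 2) ℂ) = !![g * a, g * b; -(g * star b), g * star a] := by
  set M : Matrix (Fin 2) (Fin 2) ℂ := u.1 with hM
  have hMM : M * Mᴴ = 1 := coe_mul_conjTranspose_self u
  have hadj : M.adjugate = M.det • Mᴴ := by
    have h1 := congrArg (fun A => A * Mᴴ) (Matrix.adjugate_mul M)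
    simpa [Matrix.mul_assoc, hMM] using h1
  have hdet : M.det * star M.det = 1 := by
    rw [← Matrix.det_conjTranspose, ← Matrix.det_mul, hMM, Matrix.det_one]
  -- Dividing by a square root of the determinant leaves an element of SU(2). Its shape is read off
  -- from `adjugate = det • Mᴴ`.
  obtain ⟨g, hg⟩ := IsAlgClosed.exists_pow_nat_eq M.det (n := 2) (by norm_num)
  have hgg : g * star g = 1 := by
    rw [← hg] at hdet
    have h1 : ‖g‖ ^ 4 = 1 := by
      have h2 : g ^ 2 * star (g ^ 2) = ((‖g‖ ^ 4 : ℝ) : ℂ) := by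
        have := Complex.mul_conj' (g ^ 2)
        rw [norm_pow] at this
        simp only [Complex.star_def]
        rw [this]
        push_cast
        ring
      rw [h2] at hdet
      exact_mod_cast hdet
    have h3 : ‖g‖ = 1 := (pow_eq_one_iff_of_nonneg (norm_nonneg g) (by norm_num)).1 h1
    have := Complex.mul_conj' g
    rw [h3] at this
    simpa using this
  have e00 := congrFun (congrFun hadj 0) 0
  have e10 := congrFun (congrFun hadj 1) 0
  simp only [Matrix.adjugate_fin_two, Matrix.smul_apply, Matrix.conjTranspose_apply,
    smul_eq_mul] at e00 e10
  simp only [Matrix.of_apply, Matrix.cons_val', Matrix.cons_val_zero, Matrix.cons_val_one,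
    Matrix.cons_val_fin_one] at e00 e10
  have hrow := congrFun (congrFun hMM 0) 0
  simp only [Matrix.mul_apply, Fin.sum_univ_two, Matrix.conjTranspose_apply,
    Matrix.one_apply_eq] at hrow
  refine ⟨g, star g * M 0 0, star g * M 0 1, hgg, ?_, ?_⟩
  · simp only [star_mul', star_star]
    linear_combination (star g * g) * hrow + hgg
  · ext i j
    fin_cases i <;> fin_cases j
    · simp only [Fin.zero_eta, Matrix.of_apply, Matrix.cons_val', Matrix.cons_val_zero,
        Matrix.cons_val_fin_one]
      linear_combination -(M 0 0) * hgg
    · simp only [Fin.zero_eta, Fin.mk_one, Matrix.of_apply, Matrix.cons_val', Matrix.cons_val_zero,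
        Matrix.cons_val_one, Matrix.cons_val_fin_one]
      linear_combination -(M 0 1) * hgg
    · simp only [Fin.zero_eta, Fin.mk_one, Matrix.of_apply, Matrix.cons_val', Matrix.cons_val_zero,
        Matrix.cons_val_one, Matrix.cons_val_fin_one, star_mul', star_star]
      linear_combination -e10 + star (M 0 1) * hg
    · simp only [Fin.mk_one, Matrix.of_apply, Matrix.cons_val',
        Matrix.cons_val_one, Matrix.cons_val_fin_one, star_mul', star_star]
      linear_combination e00 - star (M 0 0) * hg

/-- The numerical range of a single-qubit unitary stays away from the origin. -/
theorem norm_trace_le_expectation (u : Matrix.unitaryGroup (Fin 2) ℂ) {q : ℕ}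
    (B : Matrix (Fin 2) (Fin q) ℂ) (hB : (Bᴴ * B).trace = 1) :
    ‖(u : Matrix (Fin 2) (Fin 2) ℂ).trace‖ / 2 ≤
      ‖(Bᴴ * (u : Matrix (Fin 2) (Fin 2) ℂ) * B).trace‖ := by
  obtain ⟨g, a, b, hg, -, hu⟩ := exists_phase_su2 u
  have hgn : ‖g‖ = 1 := by
    have h1 := congrArg norm hg
    rw [norm_mul, norm_star, norm_one] at h1
    nlinarith [norm_nonneg g]
  set X : ℂ := ∑ t, star (B 0 t) * B 0 t with hX
  set Y : ℂ := ∑ t, star (B 1 t) * B 1 t with hY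
  set Z : ℂ := ∑ t, star (B 0 t) * B 1 t with hZ
  have hZ' : ∑ t, star (B 1 t) * B 0 t = star Z := by
    rw [hZ, star_sum]
    refine Finset.sum_congr rfl fun t _ => ?_
    rw [star_mul', star_star, mul_comm]
  have hXs : star X = X := by
    rw [hX, star_sum]
    refine Finset.sum_congr rfl fun t _ => ?_
    rw [star_mul', star_star, mul_comm]
  have hXY : X + Y = 1 := by
    rw [← hB, hX, hY, ← Finset.sum_add_distrib]
    simp [Matrix.trace, Matrix.mul_apply, Fin.sum_univ_two]
  have htr : (Bᴴ * (u : Matrix (Fin 2) (Fin 2) ℂ) * B).trace =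
      g * (a * X + star a * Y + b * Z - star b * star Z) := by
    rw [← hZ', hX, hY, hZ, hu]
    simp only [Matrix.trace, Matrix.diag_apply, Matrix.mul_apply, Fin.sum_univ_two,
      Matrix.conjTranspose_apply, Matrix.of_apply, Matrix.cons_val', Matrix.cons_val_zero,
      Matrix.cons_val_one, Matrix.cons_val_fin_one, Finset.mul_sum, ← Finset.sum_add_distrib,
      ← Finset.sum_sub_distrib]
    refine Finset.sum_congr rfl fun t _ => ?_
    ring
  have htu : (u : Matrix (Fin 2) (Fin 2) ℂ).trace = g * ((2 * a.re : ℝ) : ℂ) := by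
    rw [hu, Matrix.trace_fin_two]
    simp only [Matrix.of_apply, Matrix.cons_val', Matrix.cons_val_zero, Matrix.cons_val_one,
      Matrix.cons_val_fin_one]
    rw [← mul_add, Complex.star_def, Complex.add_conj]
  -- The off-diagonal part is purely imaginary and `X + Y = 1`, so the real part is the same for
  -- every state.
  have hre : (a * X + star a * Y + b * Z - star b * star Z).re = a.re := by
    have hXi : X.im = 0 := by
      have := congrArg Complex.im hXs
      simp at this
      linarith
    have hYr : Y.re = 1 - X.re := by
      have := congrArg Complex.re hXY
      simp at this
      linarith
    have hYi : Y.im = 0 := by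
      have := congrArg Complex.im hXY
      simp at this
      linarith
    simp [hXi, hYr, hYi]
    ring
  rw [htr, htu, norm_mul, norm_mul, hgn, one_mul, one_mul, Complex.norm_real, Real.norm_eq_abs,
    abs_mul, abs_two, mul_div_cancel_left₀ _ (two_ne_zero), ← hre]
  exact Complex.abs_re_le_norm _

/-! ### Equivalence with the controlled-NOT -/

theorem LocallyEquivalent.trans {U V W : TwoQubitOp} (h : LocallyEquivalent U V)
    (h' : LocallyEquivalent V W) : LocallyEquivalent U W := by
  obtain ⟨v₁, v₂, w₁, w₂, rfl⟩ := h
  obtain ⟨v₁', v₂', w₁', w₂', rfl⟩ := h'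
  refine ⟨v₁ * v₁', v₂ * v₂', w₁' * w₁, w₂' * w₂, ?_⟩
  simp only [Submonoid.coe_mul, Matrix.mul_kronecker_mul, Matrix.mul_assoc]

theorem exists_unimodular_mul_eq_norm (b : ℂ) :
    ∃ τ : ℂ, τ * star τ = 1 ∧ b * τ = ‖b‖ := by
  rcases eq_or_ne b 0 with rfl | hb
  · exact ⟨1, by simp, by simp⟩
  · have hn : (‖b‖ : ℂ) ≠ 0 := by simpa using hb
    have h := Complex.mul_conj' b
    refine ⟨star b / ‖b‖, ?_, ?_⟩
    · simp only [star_div₀, Complex.star_def, Complex.conj_ofReal, Complex.conj_conj]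
      field_simp
      linear_combination h
    · simp only [Complex.star_def]
      field_simp
      linear_combination h

/-- A traceless single-qubit unitary is conjugate to the NOT gate, up to a phase. -/
theorem exists_conj_not_of_trace_eq_zero (u : Matrix.unitaryGroup (Fin 2) ℂ)
    (hu : (u : Matrix (Fin 2) (Fin 2) ℂ).trace = 0) :
    ∃ (z : ℂ) (G : Matrix.unitaryGroup (Fin 2) ℂ), ‖z‖ = 1 ∧
      (u : Matrix (Fin 2) (Fin 2) ℂ) = z • ((G : Matrix (Fin 2) (Fin 2) ℂ) * !![0, 1; 1, 0] *
        (G : Matrix (Fin 2) (Fin 2) ℂ)ᴴ) := by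
  obtain ⟨g, a, b, hg, hab, hU⟩ := exists_phase_su2 u
  obtain ⟨τ, hτ, hbτ⟩ := exists_unimodular_mul_eq_norm b
  have hgn : ‖g‖ = 1 := by
    have h1 := congrArg norm hg
    rw [norm_mul, norm_star, norm_one] at h1
    nlinarith [norm_nonneg g]
  have hg0 : g ≠ 0 := by
    rintro rfl
    simp at hg
  have ha : star a = -a := by
    rw [hU, Matrix.trace_fin_two] at hu
    simp only [Matrix.of_apply, Matrix.cons_val', Matrix.cons_val_zero, Matrix.cons_val_one,
      Matrix.cons_val_fin_one] at hu
    have h1 : a + star a = 0 := by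
      apply mul_left_cancel₀ hg0
      linear_combination hu
    linear_combination h1
  set β : ℂ := ((‖b‖ : ℝ) : ℂ) with hβ
  have hβs : star β = β := by simp [hβ]
  have hb : b = β * star τ := by rw [← hbτ]; linear_combination -b * hτ
  have hbs : star b = β * τ := by rw [hb, star_mul', star_star, hβs]
  have hba : β * β - a * a = 1 := by
    rw [ha, hbs, hb] at hab
    linear_combination hab - β ^ 2 * hτ
  set κ : ℂ := -Complex.I * (β + a) with hκ
  have hκs : star κ = Complex.I * (β - a) := by
    rw [hκ, star_mul', star_add, hβs, ha]
    simp
    ring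
  have hI := Complex.I_mul_I
  have hκ1 : κ * star κ = 1 := by
    rw [hκs, hκ]
    linear_combination (a ^ 2 - β ^ 2) * hI + hba
  set s : ℂ := ((Real.sqrt 2 : ℝ) : ℂ)⁻¹ with hs
  have hss : s * s = 1 / 2 := by
    rw [hs, ← mul_inv]
    norm_cast
    simp
  have hsst : star s = s := by simp [hs]
  -- The phase `τ` makes the expectation of `u` at `(1, τ)/√2` vanish. So `u` swaps this vector with
  -- its orthogonal complement up to phase, and `κ` makes both phases equal to `Complex.I * g`.
  let G : Matrix (Fin 2) (Fin 2) ℂ := !![s, s * κ; s * τ, -(s * (τ * κ))]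
  have hG : G * Gᴴ = 1 := by
    ext i j
    fin_cases i <;> fin_cases j <;>
      simp only [G, Matrix.mul_apply, Fin.sum_univ_two, Matrix.conjTranspose_apply, Matrix.of_apply,
        Matrix.cons_val', Matrix.cons_val_zero, Matrix.cons_val_one, Matrix.cons_val_fin_one,
        Fin.zero_eta, Fin.mk_one, star_mul', star_neg, hsst, Matrix.one_apply_eq, ne_eq,
        Fin.reduceEq, not_false_eq_true, Matrix.one_apply_ne]
    · linear_combination 2 * hss + s * s * hκ1
    · linear_combination -s * s * star τ * hκ1
    · linear_combination -s * s * τ * hκ1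
    · linear_combination 2 * hss + (s * s + s * s * κ * star κ) * hτ + s * s * hκ1
  have huG : (u : Matrix (Fin 2) (Fin 2) ℂ) * G = (Complex.I * g) • (G * !![0, 1; 1, 0]) := by
    rw [hU]
    ext i j
    fin_cases i <;> fin_cases j <;>
      simp only [G, Matrix.mul_apply, Fin.sum_univ_two, Matrix.smul_apply, Matrix.of_apply,
        Matrix.cons_val', Matrix.cons_val_zero, Matrix.cons_val_one, Matrix.cons_val_fin_one,
        Fin.zero_eta, Fin.mk_one, smul_eq_mul, ha, hbs]
    · linear_combination g * s * hbτ - g * s * Complex.I * hκ + g * s * (a + β) * hI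
    · linear_combination -g * s * κ * hbτ + g * s * (a - β) * hκ + g * s * Complex.I * hba
    · linear_combination g * s * τ * Complex.I * hκ - g * s * τ * (a + β) * hI
    · linear_combination g * s * τ * (a - β) * hκ + g * s * τ * Complex.I * hba
  refine ⟨Complex.I * g, ⟨G, Matrix.mem_unitaryGroup_iff.2 hG⟩, by simp [hgn], ?_⟩
  change _ = (Complex.I * g) • (G * !![0, 1; 1, 0] * Gᴴ)
  rw [← Matrix.smul_mul, ← huG, Matrix.mul_assoc, hG, Matrix.mul_one]

/-- The scalar phase of `u` becomes `diag(1, z)` on the control, and the conjugation by `G` is local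
on the target. -/
theorem controlled_locallyEquivalent_cnot (u : Matrix.unitaryGroup (Fin 2) ℂ)
    (hu : (u : Matrix (Fin 2) (Fin 2) ℂ).trace = 0) : LocallyEquivalent (controlled u) cnot := by
  obtain ⟨z, G, hz, hG⟩ := exists_conj_not_of_trace_eq_zero u hu
  refine ⟨phaseGate z hz, G, 1, star G, ?_⟩
  rw [cnot, locallyEquivalent_controlled_eq, controlled, hG]
  have h1 : (G : Matrix (Fin 2) (Fin 2) ℂ) * ((star G : Matrix.unitaryGroup (Fin 2) ℂ) :
      Matrix (Fin 2) (Fin 2) ℂ) = 1 := coe_mul_conjTranspose_self G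
  rw [h1, Matrix.kronecker_smul, ← Matrix.smul_kronecker, OneMemClass.coe_one, Matrix.mul_one,
    Matrix.mul_one]
  congr 2
  · ext i j
    fin_cases i <;> fin_cases j <;> simp [phaseGate, Matrix.mul_apply]
  · ext i j
    fin_cases i <;> fin_cases j <;> simp [phaseGate, Matrix.mul_apply]

/-! ### Entangling power -/

/-- A state vector of a qubit with an ancilla, as a matrix. -/
def ancillaMatrix {p : ℕ} (α : Fin 2 × Fin p → ℂ) : Matrix (Fin 2) (Fin p) ℂ :=
  Matrix.of fun i s => α (i, s)

theorem isPureState_iff_trace {p : ℕ} {α : Fin 2 × Fin p → ℂ} :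
    IsPureState α ↔ ((ancillaMatrix α)ᴴ * ancillaMatrix α).trace = 1 := by
  have h3 : ∀ z : ℂ, star z * z = ((‖z‖ ^ 2 : ℝ) : ℂ) := fun z => by
    simpa using Complex.conj_mul' z
  simp only [Matrix.trace, Matrix.diag_apply, Matrix.mul_apply, Matrix.conjTranspose_apply,
    ancillaMatrix, Matrix.of_apply, h3]
  rw [Finset.sum_comm, ← Fintype.sum_prod_type (f := fun x => ((‖α x‖ ^ 2 : ℝ) : ℂ)), IsPureState]
  exact_mod_cast Iff.rfl

/-- Column matrix of two vectors, given as matrices. -/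
def columns {p : ℕ} (N : Fin 2 → Matrix (Fin 2) (Fin p) ℂ) : Matrix (Fin 2 × Fin p) (Fin 2) ℂ :=
  Matrix.of fun x a => N a x.1 x.2

theorem columns_gram {p : ℕ} (N : Fin 2 → Matrix (Fin 2) (Fin p) ℂ) (a b : Fin 2) :
    ((columns N)ᴴ * columns N) a b = ((N a)ᴴ * N b).trace := by
  simp only [Matrix.trace, Matrix.diag_apply, Matrix.mul_apply, Matrix.conjTranspose_apply,
    columns, Matrix.of_apply, Fintype.sum_prod_type]
  rw [Finset.sum_comm]

/-- Factoring through dimension two bounds the Schmidt number by 2 and lets the purity be computed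
from two 2 × 2 Gram matrices. -/
theorem coeffMatrix_applyToProduct {p q : ℕ} (A B : Fin 2 → Matrix (Fin 2) (Fin 2) ℂ)
    (α : Fin 2 × Fin p → ℂ) (β : Fin 2 × Fin q → ℂ) :
    coeffMatrix (applyToProduct (A 0 ⊗ₖ B 0 + A 1 ⊗ₖ B 1) α β) =
      columns (fun a => A a * ancillaMatrix α) * (columns fun a => B a * ancillaMatrix β)ᵀ := by
  ext ⟨i, s⟩ ⟨j, t⟩
  simp only [coeffMatrix, applyToProduct, columns, Matrix.of_apply, Matrix.mul_apply,
    Matrix.transpose_apply, Fin.sum_univ_two, Matrix.add_apply, Matrix.kroneckerMap_apply,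
    ancillaMatrix]
  ring

/-- The state created from a product state by a controlled unitary has a binary Schmidt spectrum,
whose distance from the uniform one is bounded from below by the trace of the unitary. -/
theorem exists_binEntropy_applyToProduct {U : TwoQubitOp} {u : Matrix.unitaryGroup (Fin 2) ℂ}
    (hU : LocallyEquivalent U (controlled u)) {p q : ℕ} {α : Fin 2 × Fin p → ℂ}
    {β : Fin 2 × Fin q → ℂ} (hα : IsPureState α) (hβ : IsPureState β) :
    ∃ x : ℝ, 0 ≤ x ∧ x ≤ 1 ∧
      entanglement (applyToProduct U α β) = Real.binEntropy x / Real.log 2 ∧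
      (‖(u : Matrix (Fin 2) (Fin 2) ℂ).trace‖ / 4) ^ 2 ≤ (x - 2⁻¹) ^ 2 := by
  obtain ⟨v₁, v₂, w₁, w₂, rfl⟩ := hU
  have hsand : ∀ (v w : Matrix.unitaryGroup (Fin 2) ℂ) (N N' : Matrix (Fin 2) (Fin 2) ℂ) {r : ℕ}
      (D : Matrix (Fin 2) (Fin r) ℂ), (v.1 * N * w.1 * D)ᴴ * (v.1 * N' * w.1 * D) =
        (w.1 * D)ᴴ * (Nᴴ * N') * (w.1 * D) := by
    intro v w N N' r D
    calc _ = (w.1 * D)ᴴ * (Nᴴ * ((v.1)ᴴ * v.1) * N') * (w.1 * D) := by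
          simp only [Matrix.conjTranspose_mul, Matrix.mul_assoc]
      _ = _ := by rw [coe_conjTranspose_mul_self, Matrix.mul_one]
  have hiso : ∀ (w : Matrix.unitaryGroup (Fin 2) ℂ) {r : ℕ} (D : Matrix (Fin 2) (Fin r) ℂ),
      (w.1 * D)ᴴ * (w.1 * D) = Dᴴ * D := by
    intro w r D
    calc _ = Dᴴ * ((w.1)ᴴ * w.1) * D := by simp only [Matrix.conjTranspose_mul, Matrix.mul_assoc]
      _ = _ := by rw [coe_conjTranspose_mul_self, Matrix.mul_one]
  let A : Fin 2 → Matrix (Fin 2) (Fin 2) ℂ := fun a => v₁.1 * Matrix.single a a 1 * w₁.1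
  let B : Fin 2 → Matrix (Fin 2) (Fin 2) ℂ := fun a => v₂.1 * (![1, u.1] a) * w₂.1
  have hform : (v₁.1 ⊗ₖ v₂.1) * controlled u.1 * (w₁.1 ⊗ₖ w₂.1) =
      A 0 ⊗ₖ B 0 + A 1 ⊗ₖ B 1 := by
    rw [locallyEquivalent_controlled_eq]
    simp [A, B]
  rw [hform]
  set ψ := applyToProduct (A 0 ⊗ₖ B 0 + A 1 ⊗ₖ B 1) α β with hψ
  set X := columns fun a => A a * ancillaMatrix α with hX
  set Y := columns fun a => B a * ancillaMatrix β with hY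
  have hC : coeffMatrix ψ = X * Yᵀ := coeffMatrix_applyToProduct A B α β
  set g := Xᴴ * X with hg
  set h := Yᵀ * Yᵀᴴ with hh
  have hR : reduced ψ = X * h * Xᴴ := by
    rw [reduced, hC, Matrix.conjTranspose_mul]
    simp only [hh, Matrix.mul_assoc]
  have htr1 : (reduced ψ).trace = (g * h).trace := by
    rw [hR, Matrix.trace_mul_comm, ← Matrix.mul_assoc]
  have htr2 : (reduced ψ * reduced ψ).trace = (g * h * (g * h)).trace := by
    calc _ = (X * (h * Xᴴ * X * h * Xᴴ)).trace := by rw [hR]; simp only [Matrix.mul_assoc]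
      _ = (h * (g * h * g)).trace := by
        rw [Matrix.trace_mul_comm]; simp only [hg, Matrix.mul_assoc]
      _ = _ := by rw [Matrix.trace_mul_comm]; simp only [Matrix.mul_assoc]
  have hgab : ∀ a b, g a b = ((w₁.1 * ancillaMatrix α)ᴴ *
      ((Matrix.single a a (1 : ℂ))ᴴ * Matrix.single b b (1 : ℂ)) * (w₁.1 * ancillaMatrix α)).trace := by
    intro a b
    rw [hg, hX, columns_gram]
    exact congrArg _ (hsand v₁ w₁ _ _ _)
  have hhab : ∀ a b, h b a = ((w₂.1 * ancillaMatrix β)ᴴ *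
      ((![1, u.1] a)ᴴ * ![1, u.1] b) * (w₂.1 * ancillaMatrix β)).trace := by
    intro a b
    have h1 : h b a = (Yᴴ * Y) a b := by
      simp only [hh, Matrix.mul_apply, Matrix.conjTranspose_apply, Matrix.transpose_apply]
      exact Finset.sum_congr rfl fun x _ => mul_comm _ _
    rw [h1, hY, columns_gram]
    exact congrArg _ (hsand v₂ w₂ _ _ _)
  have hg01 : g 0 1 = 0 := by rw [hgab]; simp
  have hg10 : g 1 0 = 0 := by rw [hgab]; simp
  have hgsum : g 0 0 + g 1 1 = 1 := by
    have h1 : (Matrix.single 0 0 1)ᴴ * Matrix.single 0 0 1 +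
        (Matrix.single 1 1 1)ᴴ * Matrix.single 1 1 1 = (1 : Matrix (Fin 2) (Fin 2) ℂ) := by
      ext i j
      fin_cases i <;> fin_cases j <;> simp
    rw [hgab, hgab, ← Matrix.trace_add, ← Matrix.add_mul, ← Matrix.mul_add, h1, Matrix.mul_one,
      hiso, isPureState_iff_trace.1 hα]
  have hgreal : ∀ a, ∃ r : ℝ, 0 ≤ r ∧ g a a = r := by
    intro a
    have h1 := (Matrix.posSemidef_conjTranspose_mul_self X).diag_nonneg (i := a)
    refine ⟨(g a a).re, (Complex.nonneg_iff.1 h1).1, ?_⟩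
    exact (Complex.ext rfl (Complex.nonneg_iff.1 h1).2.symm)
  have hh00 : h 0 0 = 1 := by
    rw [hhab]
    simp only [Matrix.cons_val_zero, Matrix.conjTranspose_one, Matrix.mul_one]
    rw [hiso, isPureState_iff_trace.1 hβ]
  have hh11 : h 1 1 = 1 := by
    rw [hhab]
    simp only [Matrix.cons_val_one, Matrix.cons_val_fin_one, coe_conjTranspose_mul_self,
      Matrix.mul_one]
    rw [hiso, isPureState_iff_trace.1 hβ]
  have hhs : h 0 1 = star (h 1 0) := by
    have : hᴴ = h := by rw [hh]; simp
    conv_lhs => rw [← this]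
    rfl
  -- The off-diagonal entry of `h` is the expectation of `u` in Bob's rotated input state.
  have hlow : ‖u.1.trace‖ / 2 ≤ ‖h 1 0‖ := by
    rw [hhab]
    have := norm_trace_le_expectation u (w₂.1 * ancillaMatrix β)
      (by rw [hiso, isPureState_iff_trace.1 hβ])
    simpa using this
  obtain ⟨g₀, hg0n, hg0⟩ := hgreal 0
  obtain ⟨g₁, hg1n, hg1⟩ := hgreal 1
  have hg01s : g₀ + g₁ = 1 := by
    rw [hg0, hg1] at hgsum
    exact_mod_cast hgsum
  have htrace : (reduced ψ).trace = 1 := by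
    rw [htr1, Matrix.trace_fin_two]
    simp only [Matrix.mul_apply, Fin.sum_univ_two, hg01, hg10, hh00, hh11]
    linear_combination hgsum
  have hpur : (reduced ψ * reduced ψ).trace =
      ((g₀ ^ 2 + g₁ ^ 2 + 2 * g₀ * g₁ * ‖h 1 0‖ ^ 2 : ℝ) : ℂ) := by
    have hn : h 1 0 * star (h 1 0) = ((‖h 1 0‖ ^ 2 : ℝ) : ℂ) := by
      simpa using Complex.mul_conj' (h 1 0)
    rw [htr2, Matrix.trace_fin_two]
    simp only [Matrix.mul_apply, Fin.sum_univ_two, hg01, hg10, hh00, hh11, hg0, hg1, hhs]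
    push_cast at hn ⊢
    linear_combination 2 * (g₀ : ℂ) * g₁ * hn
  have hrank : schmidtNumber ψ ≤ 2 := by
    rw [schmidtNumber_eq_rank, hC]
    exact (Matrix.rank_mul_le_left _ _).trans ((Matrix.rank_le_card_width X).trans (by simp))
  obtain ⟨x, hx0, hx1, hent, htrx⟩ := exists_binEntropy ψ htrace hrank
  refine ⟨x, hx0, hx1, hent, ?_⟩
  rw [hpur] at htrx
  have hx : g₀ ^ 2 + g₁ ^ 2 + 2 * g₀ * g₁ * ‖h 1 0‖ ^ 2 = x ^ 2 + (1 - x) ^ 2 := by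
    exact_mod_cast htrx
  have hsq : (‖u.1.trace‖ / 2) ^ 2 ≤ ‖h 1 0‖ ^ 2 :=
    pow_le_pow_left₀ (by positivity) hlow 2
  have hg1e : g₁ = 1 - g₀ := by linarith
  have hprod : 0 ≤ g₀ * g₁ := mul_nonneg hg0n hg1n
  set T := ‖u.1.trace‖ with hT
  have hquarter : 0 ≤ 1 - 4 * (g₀ * g₁) := by
    rw [hg1e]
    nlinarith [sq_nonneg (1 - 2 * g₀)]
  have hle : ‖h 1 0‖ ^ 2 ≤ 1 := by
    have hdet := (Matrix.posSemidef_self_mul_conjTranspose Yᵀ).det_nonneg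
    rw [← hh, Matrix.det_fin_two, hh00, hh11, hhs] at hdet
    have hn : star (h 1 0) * h 1 0 = ((‖h 1 0‖ ^ 2 : ℝ) : ℂ) := by
      simpa using Complex.conj_mul' (h 1 0)
    rw [hn] at hdet
    have h1 : (0 : ℂ) ≤ ((1 - ‖h 1 0‖ ^ 2 : ℝ) : ℂ) := by
      push_cast at hdet ⊢
      simpa using hdet
    have h3 : 0 ≤ 1 - ‖h 1 0‖ ^ 2 := by exact_mod_cast h1
    linarith
  have hxx : 2 * (x - 2⁻¹) ^ 2 = 1 / 2 - 2 * (g₀ * g₁) * (1 - ‖h 1 0‖ ^ 2) := by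
    rw [hg1e] at hx ⊢
    linear_combination -hx
  -- The deviation from 1/2 is least at `g₀ * g₁ = 1/4` and minimal overlap. The hints are `(1 - 4
  -- g₀ g₁)(1 - T²/4) ≥ 0` and `g₀ g₁ (|h 1 0|² - T²/4) ≥ 0`.
  nlinarith [mul_nonneg hquarter (sub_nonneg.2 (hsq.trans hle)),
    mul_nonneg hprod (sub_nonneg.2 hsq)]

/-- Every operation equivalent to the controlled-NOT creates an ebit. -/
theorem exists_entanglement_eq_one_of_cnot {U : TwoQubitOp} (hU : LocallyEquivalent U cnot) :
    ∃ (α β : Fin 2 × Fin 1 → ℂ), IsPureState α ∧ IsPureState β ∧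
      entanglement (applyToProduct U α β) = 1 := by
  obtain ⟨v₁, v₂, w₁, w₂, rfl⟩ := hU
  set s : ℂ := ((Real.sqrt 2 : ℝ) : ℂ)⁻¹ with hs
  have hss : s * s = 1 / 2 := by
    rw [hs, ← mul_inv]
    norm_cast
    simp
  have hsst : star s = s := by simp [hs]
  -- The inputs are `|+⟩` and `|0⟩`, pulled back through `w₁` and `w₂`. The ancillas are trivial.
  let c : Matrix (Fin 2) (Fin 1) ℂ := !![s; s]
  let d : Matrix (Fin 2) (Fin 1) ℂ := !![1; 0]
  let α : Fin 2 × Fin 1 → ℂ := fun x => ((w₁.1)ᴴ * c) x.1 x.2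
  let β : Fin 2 × Fin 1 → ℂ := fun x => ((w₂.1)ᴴ * d) x.1 x.2
  have hα : ancillaMatrix α = (w₁.1)ᴴ * c := rfl
  have hβ : ancillaMatrix β = (w₂.1)ᴴ * d := rfl
  have hcancel : ∀ {k : ℕ} (w : Matrix.unitaryGroup (Fin 2) ℂ) (N : Matrix (Fin k) (Fin 2) ℂ)
      (D : Matrix (Fin 2) (Fin 1) ℂ), N * w.1 * ((w.1)ᴴ * D) = N * D := by
    intro k w N D
    rw [Matrix.mul_assoc, ← Matrix.mul_assoc w.1, coe_mul_conjTranspose_self, Matrix.one_mul]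
  have hnorm : ∀ (w : Matrix.unitaryGroup (Fin 2) ℂ) (D : Matrix (Fin 2) (Fin 1) ℂ),
      ((w.1)ᴴ * D)ᴴ * ((w.1)ᴴ * D) = Dᴴ * D := by
    intro w D
    rw [Matrix.conjTranspose_mul, Matrix.conjTranspose_conjTranspose]
    exact hcancel w _ _
  let A : Fin 2 → Matrix (Fin 2) (Fin 2) ℂ := fun a => v₁.1 * Matrix.single a a 1 * w₁.1
  let B : Fin 2 → Matrix (Fin 2) (Fin 2) ℂ := fun a => v₂.1 * (![1, !![0, 1; 1, 0]] a) * w₂.1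
  have hform : (v₁.1 ⊗ₖ v₂.1) * cnot * (w₁.1 ⊗ₖ w₂.1) = A 0 ⊗ₖ B 0 + A 1 ⊗ₖ B 1 := by
    rw [cnot, locallyEquivalent_controlled_eq]
    simp [A, B]
  refine ⟨α, β, ?_, ?_, ?_⟩
  · rw [isPureState_iff_trace, hα, hnorm]
    simp only [Matrix.trace, Matrix.diag_apply, Matrix.mul_apply, Matrix.conjTranspose_apply, c,
      Fin.sum_univ_two, Finset.univ_unique, Finset.sum_singleton, Matrix.of_apply,
      Matrix.cons_val', Matrix.cons_val_zero, Matrix.cons_val_one, Matrix.cons_val_fin_one, hsst]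
    linear_combination 2 * hss
  · rw [isPureState_iff_trace, hβ, hnorm]
    simp [Matrix.trace, Matrix.mul_apply, d, Fin.sum_univ_two]
  · rw [hform]
    refine (entanglement_of_reduced_eq _ ?_ (by simp)).2
    -- The two branches are orthogonal on both sides: the column matrices are `s • v₁` and `v₂`,
    -- hence the reduced operator is 1/2.
    have hX : columns (fun a => A a * ancillaMatrix α) = (s • v₁.1).submatrix Prod.fst id := by
      ext ⟨i, k⟩ a
      have h1 : A a * ancillaMatrix α = v₁.1 * Matrix.single a a 1 * c := by
        rw [hα]; exact hcancel _ _ _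
      simp only [columns, Matrix.of_apply, h1, Matrix.submatrix_apply, id, Matrix.smul_apply]
      fin_cases a <;> fin_cases k <;>
        simp [Matrix.mul_apply, Fin.sum_univ_two, c, mul_comm, Matrix.single_apply]
    have hY : (columns fun a => B a * ancillaMatrix β)ᵀ = (v₂.1ᵀ).submatrix id Prod.fst := by
      ext a ⟨i, k⟩
      have h1 : B a * ancillaMatrix β = v₂.1 * (![1, !![0, 1; 1, 0]] a) * d := by
        rw [hβ]; exact hcancel _ _ _
      simp only [columns, Matrix.of_apply, h1, Matrix.submatrix_apply, id, Matrix.transpose_apply]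
      fin_cases a <;> fin_cases k <;>
        simp [Matrix.mul_apply, Fin.sum_univ_two, d]
    have hh : v₂.1ᵀ.submatrix id (Prod.fst : Fin 2 × Fin 1 → Fin 2) *
        (v₂.1ᵀ.submatrix id (Prod.fst : Fin 2 × Fin 1 → Fin 2))ᴴ = 1 := by
      ext a b
      have h1 := congrFun (congrFun (coe_conjTranspose_mul_self v₂) b) a
      simp only [Matrix.mul_apply, Matrix.conjTranspose_apply, Matrix.submatrix_apply,
        Matrix.transpose_apply, id, Fintype.sum_prod_type, Finset.univ_unique,
        Finset.sum_singleton] at h1 ⊢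
      have h2 : (1 : Matrix (Fin 2) (Fin 2) ℂ) a b = (1 : Matrix (Fin 2) (Fin 2) ℂ) b a := by
        simp [Matrix.one_apply, eq_comm]
      rw [h2, ← h1]
      exact Finset.sum_congr rfl fun x _ => mul_comm _ _
    rw [reduced, coeffMatrix_applyToProduct, hX, hY, Matrix.conjTranspose_mul, Matrix.mul_assoc,
      ← Matrix.mul_assoc (v₂.1ᵀ.submatrix id _), hh, Matrix.one_mul]
    ext ⟨i, k⟩ ⟨i', k'⟩
    have h1 := congrFun (congrFun (coe_mul_conjTranspose_self v₁) i) i'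
    have hk : k = k' := Subsingleton.elim _ _
    have h2 : ((1 : Matrix (Fin 2 × Fin 1) (Fin 2 × Fin 1) ℂ) (i, k) (i', k')) =
        (1 : Matrix (Fin 2) (Fin 2) ℂ) i i' := by
      simp [Matrix.one_apply, hk]
    rw [Matrix.smul_apply, h2, ← h1]
    simp only [Matrix.mul_apply, Matrix.conjTranspose_apply, Matrix.submatrix_apply, id,
      Matrix.smul_apply, smul_eq_mul, star_mul', hsst, Finset.mul_sum]
    refine Finset.sum_congr rfl fun x _ => ?_
    push_cast
    linear_combination (v₁.1 i x * star (v₁.1 i' x)) * hss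

theorem entanglement_applyToProduct_le_one {U : TwoQubitOp} (hU : IsControlledUnitary U) {p q : ℕ}
    {α : Fin 2 × Fin p → ℂ} {β : Fin 2 × Fin q → ℂ} (hα : IsPureState α) (hβ : IsPureState β) :
    entanglement (applyToProduct U α β) ≤ 1 := by
  obtain ⟨u, hu⟩ := hU
  obtain ⟨x, -, -, hent, -⟩ := exists_binEntropy_applyToProduct hu hα hβ
  rw [hent, div_le_one (Real.log_pos one_lt_two)]
  exact Real.binEntropy_le_log_two

theorem entanglingPower_le_one {U : TwoQubitOp} (hU : IsControlledUnitary U) :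
    entanglingPower U ≤ 1 := by
  refine iSup_le fun p => iSup_le fun q => iSup_le fun α => iSup_le fun β => iSup_le fun hα =>
    iSup_le fun hβ => ?_
  exact_mod_cast entanglement_applyToProduct_le_one hU hα hβ

/-- Away from the controlled-NOT, the created entanglement is bounded away from one ebit. -/
theorem exists_entanglement_bound {U : TwoQubitOp} (hU : IsControlledUnitary U)
    (hcnot : ¬ LocallyEquivalent U cnot) :
    ∃ b : ℝ, b < 1 ∧ ∀ (p q : ℕ) (α : Fin 2 × Fin p → ℂ) (β : Fin 2 × Fin q → ℂ),
      IsPureState α → IsPureState β → entanglement (applyToProduct U α β) ≤ b := by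
  obtain ⟨u, hu⟩ := hU
  have htr : (u : Matrix (Fin 2) (Fin 2) ℂ).trace ≠ 0 := fun h =>
    hcnot (hu.trans (controlled_locallyEquivalent_cnot u h))
  have hlog : 0 < Real.log 2 := Real.log_pos one_lt_two
  set δ := ‖(u : Matrix (Fin 2) (Fin 2) ℂ).trace‖ / 4 with hδ
  have hδ0 : 0 < δ := by
    have := norm_pos_iff.2 htr
    positivity
  -- The spectrum `x` keeps distance at least `δ` from 1/2 uniformly in the inputs and ancillas, so
  -- the supremum itself stays below 1. The case `x > 1/2` follows by the symmetry `x ↦ 1 - x`.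
  refine ⟨Real.binEntropy (2⁻¹ - δ) / Real.log 2, ?_, ?_⟩
  · rw [div_lt_one hlog, Real.binEntropy_lt_log_two]
    linarith
  · intro p q α β hα hβ
    obtain ⟨x, hx0, hx1, hent, hx⟩ := exists_binEntropy_applyToProduct hu hα hβ
    rw [hent]
    refine div_le_div_of_nonneg_right ?_ hlog.le
    have habs : δ ≤ |x - 2⁻¹| := by
      rw [← abs_of_pos hδ0]
      exact sq_le_sq.1 hx
    have hmono : ∀ y : ℝ, 0 ≤ y → y ≤ 2⁻¹ - δ →
        Real.binEntropy y ≤ Real.binEntropy (2⁻¹ - δ) := by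
      intro y hy0 hy
      exact Real.binEntropy_strictMonoOn.monotoneOn ⟨hy0, by linarith⟩
        ⟨by linarith, by linarith⟩ hy
    rcases le_total x 2⁻¹ with h | h
    · rw [abs_of_nonpos (by linarith)] at habs
      exact hmono x hx0 (by linarith)
    · rw [abs_of_nonneg (by linarith)] at habs
      rw [← Real.binEntropy_one_sub]
      refine hmono _ (by linarith) ?_
      norm_num at habs ⊢
      linarith

theorem entanglingPower_lt_one_iff {U : TwoQubitOp} (hU : IsControlledUnitary U) :
    entanglingPower U < 1 ↔ ¬ LocallyEquivalent U cnot := by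
  constructor
  · intro hlt hcnot
    obtain ⟨α, β, hα, hβ, h1⟩ := exists_entanglement_eq_one_of_cnot hcnot
    refine absurd hlt (not_lt.2 ?_)
    have h2 : (1 : EReal) = ((entanglement (applyToProduct U α β) : ℝ) : EReal) := by
      rw [h1, EReal.coe_one]
    rw [h2]
    exact le_iSup_of_le 1 <| le_iSup_of_le 1 <| le_iSup_of_le α <| le_iSup_of_le β <|
      le_iSup_of_le hα <| le_iSup_of_le hβ le_rfl
  · intro hcnot
    obtain ⟨b, hb, hbound⟩ := exists_entanglement_bound hU hcnot
    refine lt_of_le_of_lt (b := (b : EReal)) ?_ (by exact_mod_cast hb)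
    refine iSup_le fun p => iSup_le fun q => iSup_le fun α => iSup_le fun β => iSup_le fun hα =>
      iSup_le fun hβ => ?_
    exact_mod_cast hbound p q α β hα hβ

/-- The Bell state is a maximally entangled resource with one ebit. -/
theorem exists_bell_state : ∃ ψ : Fin 2 × Fin 2 → ℂ, IsPureState ψ ∧ schmidtNumber ψ = 2 ∧
    IsMaximallyEntangled ψ ∧ entanglement ψ = 1 := by
  let ψ : Fin 2 × Fin 2 → ℂ := fun x => if x.1 = x.2 then ((Real.sqrt 2 : ℝ) : ℂ)⁻¹ else 0
  have hR : reduced ψ = ((1 / 2 : ℝ) : ℂ) • 1 := by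
    have hs : ((Real.sqrt 2 : ℝ) : ℂ)⁻¹ * ((Real.sqrt 2 : ℝ) : ℂ)⁻¹ = 2⁻¹ := by
      rw [← mul_inv]
      norm_cast
      simp
    ext i j
    fin_cases i <;> fin_cases j <;> simp [reduced, coeffMatrix, Matrix.mul_apply, ψ, hs]
  refine ⟨ψ, ?_, schmidtNumber_of_reduced_eq ψ hR, entanglement_of_reduced_eq ψ hR (by simp)⟩
  simp only [IsPureState, Fintype.sum_prod_type, Fin.sum_univ_two, ψ]
  norm_num

end LOCCCost
end

/-! ### Entanglement cost and its gap to the entangling power -/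

theorem mainTheorem1 (U : LOCCCost.TwoQubitOp)
    (hU : LOCCCost.IsControlledUnitary U)
    (hne : ¬ LOCCCost.LocallyEquivalent U 1) :
    -- a resource of Schmidt number 2 has to be maximally entangled, with exactly 1 ebit
    (∀ (m n : ℕ) (ψ : Fin m × Fin n → ℂ),
      LOCCCost.IsPureState ψ → LOCCCost.schmidtNumber ψ = 2 →
      (∃ P : LOCCCost.LOCC 2 2 (2 * m) (2 * n), LOCCCost.Implements P ψ U) →
      LOCCCost.IsMaximallyEntangled ψ ∧ LOCCCost.entanglement ψ = 1) ∧
    -- conversely every such resource suffices, by a three-turn protocol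
    (∀ (m n : ℕ) (ψ : Fin m × Fin n → ℂ),
      LOCCCost.IsPureState ψ → LOCCCost.schmidtNumber ψ = 2 →
      LOCCCost.IsMaximallyEntangled ψ →
      ∃ P : LOCCCost.LOCC 2 2 (2 * m) (2 * n), P.turns = 3 ∧ LOCCCost.Implements P ψ U) ∧
    -- the minimum entanglement cost over resources of Schmidt number 2 is 1 ebit
    IsLeast {E : ℝ | ∃ (m n : ℕ) (ψ : Fin m × Fin n → ℂ),
      LOCCCost.IsPureState ψ ∧ LOCCCost.schmidtNumber ψ = 2 ∧
      (∃ P : LOCCCost.LOCC 2 2 (2 * m) (2 * n), LOCCCost.Implements P ψ U) ∧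
      E = LOCCCost.entanglement ψ} 1 ∧
    -- the gap: the entangling power is smaller, except for the operations equivalent to CNOT
    LOCCCost.entanglingPower U ≤ 1 ∧
    (LOCCCost.entanglingPower U < 1 ↔ ¬ LOCCCost.LocallyEquivalent U LOCCCost.cnot) := by
  have hrigid : ∀ (m n : ℕ) (ψ : Fin m × Fin n → ℂ),
      LOCCCost.IsPureState ψ → LOCCCost.schmidtNumber ψ = 2 →
      (∃ P : LOCCCost.LOCC 2 2 (2 * m) (2 * n), LOCCCost.Implements P ψ U) →
      LOCCCost.IsMaximallyEntangled ψ ∧ LOCCCost.entanglement ψ = 1 := by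
    rintro m n ψ hψ h2 ⟨P, hP⟩
    exact LOCCCost.maximallyEntangled_of_reduced ψ
      (LOCCCost.reduced_mul_self_of_implements hU hne hψ h2 hP) h2
  refine ⟨hrigid, fun m n ψ hψ h2 hme => LOCCCost.exists_protocol_of_maximallyEntangled hU hψ h2 hme,
    ⟨?_, ?_⟩, LOCCCost.entanglingPower_le_one hU, LOCCCost.entanglingPower_lt_one_iff hU⟩
  · obtain ⟨ψ, hψ, h2, hme, hE⟩ := LOCCCost.exists_bell_state
    obtain ⟨P, -, hP⟩ := LOCCCost.exists_protocol_of_maximallyEntangled hU hψ h2 hme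
    exact ⟨2, 2, ψ, hψ, h2, ⟨P, hP⟩, hE.symm⟩
  · rintro E ⟨m, n, ψ, hψ, h2, hP, rfl⟩
    exact (hrigid m n ψ hψ h2 hP).2.ge
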